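/- **Conventions.** A vocabulary is a finite set of relation symbols of finite arities; structures are finite with nonempty universe, graphs are finite, simple and have nonempty vertex set. A structure is a *core* if all its endomorphisms are injective; $\mathsf{core}(\mathbf A)$ is a core $\mathbf B$ with $B\subseteq A$, $R^{\mathbf B}\subseteq R^{\mathbf A}$ for all symbols $R$, and a homomorphism $\mathbf A\to\mathbf B$ (it is unique up to isomorphism). $\mathsf{graph}(\mathbf A)$ has vertex set $A$ and an edge between distinct $a,a'$ if both are components of some tuple in some relation of $\mathbf A$. For a set $\mathcal A$ of structures (possibly of different vocabularies), $\mathsf{graph}(\mathsf{core}(\mathcal A))=\{\mathsf{graph}(\mathsf{core}(\mathbf A)) : \mathbf A\in\mathcal A\}$. *Games.* A game vector with $m\ge 1$ rounds is a tuple $v=(p_1,\dots,p_m)\in\mathbb N^m$. A partial homomorphism from $\mathbf A$ to $\mathbf B$ is either the empty map or a homomorphism to $\mathbf B$ from the substructure of $\mathbf A$ induced on its domain. A Duplicator winning strategy for the $v$-game on $(\mathbf A,\mathbf B)$ is a sequence $W_1,\dots,W_m$ of sets of partial homomorphisms from $\mathbf A$ to $\mathbf B$ such that for each $S\subseteq A$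 with $|S|\le p_1$ some map in $W_1$ has domain $S$, and whenever $1\le i<m$, $g\in W_i$, $\mathrm{dom}(g)\subseteq S\subseteq A$ and $|S\setminus \mathrm{dom}(g)|\le p_{i+1}$, some $g'\in W_{i+1}$ extends $g$ and has domain $S$. The $v$-game *solves* $p\text{-}\mathrm{HOM}(\mathcal A)$ if for each $\mathbf A\in\mathcal A$ and each structure $\mathbf B$ of the same vocabulary, existence of a Duplicator winning strategy for the $v$-game on $(\mathbf A,\mathbf B)$ implies existence of a homomorphism $\mathbf A\to\mathbf B$. *Graphs.* The height of a rooted tree is the maximum length (number of edges) of a path from the root; the height of a tree is the minimum over all its rootings; the height of a forest is the maximum height of a component. $\mathcal F_r$ is the class of all forests of height at most $r$. For a graph $\mathbf H$, write $\mathsf{refl}(E^{\mathbf H})=E^{\mathbf H}\cup\{(h,h):h\in H\}$. An $\mathbf H$-deconstruction of $\mathbf G$ is a family $(B_h)_{h\in H}$ of subsets of $G$ such that for each $(g,g')\in\mathsf{refl}(E^{\mathbf G})$ there is $(h,h')\in\mathsf{refl}(E^{\mathbf H})$ with $\{g,g'\}\subseteq B_h\cup B_{h'}$, and for each $g\in G$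 the set $\{h : g\in B_h\}$ is connected in $\mathbf H$; its width is $\max_{(h,h')\in\mathsf{refl}(E^{\mathbf H})}|B_h\cup B_{h'}|$. Write $\mathcal G\preceq\mathcal H$ if there is $k\ge1$ such that each $\mathbf G\in\mathcal G$ has an $\mathbf H$-deconstruction of width at most $k$ for some $\mathbf H\in\mathcal H$. The tree depth of a connected graph $\mathbf G$ is the minimum height of a rooted tree with vertex set $G$ such that for each edge of $\mathbf G$ one endpoint is an ancestor of the other in the tree; the tree depth of a graph is the maximum over its components. A set of graphs has bounded tree depth if a constant bounds the tree depth of all its members. A minor map from $\mathbf M$ to $\mathbf G$ assigns to the vertices of $\mathbf M$ pairwise disjoint, nonempty, connected subsets of $G$ such that for each edge $(m,m')$ of $\mathbf M$ there is an edge of $\mathbf G$ between the sets assigned to $m$ and $m'$; $\mathsf{minors}(\mathcal G)$ is the class of graphs that have a minor map to some member of $\mathcal G$. For $h\ge0$, $k\ge1$, $\mathbf T_{h,k}$ is the tree on all strings of length at most $h$ over $\{1,\dots,k\}$, each string $t$ of length $<h$ being adjacent to its extensions $ti$. The stack depth of $\mathcal G$ is $\max\{h : \mathbf T_{h,k}\in\mathsf{minors}(\mathcal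 G)\text{ for all }k\ge1\}$ ($\infty$ if this set is infinite, and $0$ if it is empty, which happens only for $\mathcal G=\emptyset$). **Theorem** (Correspondence between number of rounds and stack depth). Let $\mathcal A$ be a set of structures, let $\mathcal G=\mathsf{graph}(\mathsf{core}(\mathcal A))$, and let $r\ge0$. The following are equivalent. 1. There exists a game vector $v$ with $r+1$ rounds such that the $v$-game solves $p\text{-}\mathrm{HOM}(\mathcal A)$. 2. $\mathcal G\preceq\mathcal F_r$. 3. The set $\mathcal G$ has bounded tree depth and stack depth $\le r$. -/

import Mathlib

namespace HomGame

open FirstOrder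

/-! ## Finite relational structures -/

/-- A vocabulary: a finite set of relation symbols (of arbitrary finite arities). -/
structure Vocabulary where
  lang : FirstOrder.Language.{0, 0}
  relational : lang.IsRelational
  finite_symbols : Finite (Σ n, lang.Relations n)

attribute [instance] Vocabulary.relational

/-- A structure with vocabulary `σ`: finite, with nonempty universe. -/
structure Str (σ : Vocabulary) where
  carrier : Type
  finite : Finite carrier
  nonempty : Nonempty carrier
  interp : σ.lang.Structure carrier

attribute [instance] Str.finite Str.nonempty Str.interp

/-- The existence of a homomorphism between similar structures. -/
def HomTo {σ : Vocabulary} (A B : Str σ) : Prop :=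
  Nonempty (A.carrier →[σ.lang] B.carrier)

/-- A structure is a core if all its endomorphisms are injective. -/
def IsCore {σ : Vocabulary} (A : Str σ) : Prop :=
  ∀ h : A.carrier →[σ.lang] A.carrier, Function.Injective h

/-- A structure `B` with `B ⊆ A` and `R^B ⊆ R^A` for every relation symbol `R`. -/
structure WeakSub {σ : Vocabulary} (A : Str σ) where
  univ : Set A.carrier
  nonempty : univ.Nonempty
  interp : σ.lang.Structure univ
  rel_subset : ∀ {n : ℕ} (R : σ.lang.Relations n) (x : Fin n → univ),
    interp.RelMap R x → FirstOrder.Language.Structure.RelMap R (fun i => (x i : A.carrier))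

/-- A weak substructure as a structure in its own right. -/
def WeakSub.toStr {σ : Vocabulary} {A : Str σ} (C : WeakSub A) : Str σ where
  carrier := C.univ
  finite := inferInstance
  nonempty := C.nonempty.to_subtype
  interp := C.interp

/-- `C` is a core of `A`. -/
def IsCoreOf {σ : Vocabulary} {A : Str σ} (C : WeakSub A) : Prop :=
  HomTo A C.toStr ∧ IsCore C.toStr

/-! ## Graphs -/

/-- A finite graph with nonempty vertex set. -/
structure Graph where
  V : Type
  finite : Finite V
  nonempty : Nonempty V
  graph : SimpleGraph V

attribute [instance] Graph.finite Graph.nonempty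

/-- The graph of a structure: distinct elements are adjacent if they occur together in a tuple
of some relation. -/
def graphOf {σ : Vocabulary} (A : Str σ) : Graph where
  V := A.carrier
  finite := A.finite
  nonempty := A.nonempty
  graph :=
    { Adj := fun a a' => a ≠ a' ∧ ∃ (n : ℕ) (R : σ.lang.Relations n) (x : Fin n → A.carrier),
        FirstOrder.Language.Structure.RelMap R x ∧ a ∈ Set.range x ∧ a' ∈ Set.range x
      symm := ⟨fun _ _ ⟨hne, n, R, x, hx, ha, ha'⟩ => ⟨hne.symm, n, R, x, hx, ha', ha⟩⟩
      loopless := ⟨fun _ h => h.1 rfl⟩ }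

/-- `graph(core(𝒜))`. The structures in `𝒜` may have different vocabularies. As cores are unique
only up to isomorphism, the graphs of all cores of members of `𝒜` are included. -/
def graphCore (𝒜 : Set (Σ σ : Vocabulary, Str σ)) : Set Graph :=
  {G | ∃ A ∈ 𝒜, ∃ C : WeakSub A.2, IsCoreOf C ∧ G = graphOf C.toStr}

/-- The reflexive closure `refl(E)` of the edge relation. -/
def ReflAdj {V : Type} (G : SimpleGraph V) (g g' : V) : Prop :=
  g = g' ∨ G.Adj g g'

/-! ### Heights -/

/-- The height of a tree `T` rooted at `root`: the maximum length of a path from the root. -/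
noncomputable def rootedHeight {V : Type} (T : SimpleGraph V) (root : V) : ℕ∞ :=
  ⨆ (v : V) (p : T.Path root v), (p.1.length : ℕ∞)

/-- The height of a tree: the minimum height over all rootings. -/
noncomputable def treeHeight {V : Type} (T : SimpleGraph V) : ℕ∞ :=
  ⨅ root : V, rootedHeight T root

/-- The height of a forest: the maximum height of a component. -/
noncomputable def forestHeight {V : Type} (F : SimpleGraph V) : ℕ∞ :=
  ⨆ c : F.ConnectedComponent, treeHeight c.toSimpleGraph

/-- The class `𝓕_d` of all forests of height at most `d`. -/
def forests (d : ℕ) : Set Graph :=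
  {F | F.graph.IsAcyclic ∧ forestHeight F.graph ≤ d}

/-! ### Tree depth -/

/-- `a` is an ancestor of `d` in the tree `T` rooted at `root`: it lies on the (unique) path from
the root to `d`. -/
def IsAncestor {V : Type} (T : SimpleGraph V) (root a d : V) : Prop :=
  ∃ p : T.Path root d, a ∈ p.1.support

/-- `T` is a tree whose closure, when rooted at `root`, contains all edges of `G`. -/
def InClosure {V : Type} (G T : SimpleGraph V) (root : V) : Prop :=
  T.IsTree ∧ ∀ g g' : V, G.Adj g g' → IsAncestor T root g g' ∨ IsAncestor T root g' g

/-- Tree depth of a connected graph: the minimum height of a rooted tree on the same vertex set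
whose closure contains all edges. -/
noncomputable def connTreeDepth {V : Type} (G : SimpleGraph V) : ℕ∞ :=
  ⨅ (T : SimpleGraph V) (root : V) (_ : InClosure G T root), rootedHeight T root

/-- Tree depth of a graph: the maximum tree depth of a component. -/
noncomputable def treeDepth {V : Type} (G : SimpleGraph V) : ℕ∞ :=
  ⨆ c : G.ConnectedComponent, connTreeDepth c.toSimpleGraph

/-- A class of graphs has bounded tree depth. -/
def BoundedTreeDepth (𝒢 : Set Graph) : Prop :=
  ∃ w : ℕ, ∀ G ∈ 𝒢, treeDepth G.graph ≤ w

/-! ### Deconstructions -/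

/-- `B` is an `H`-deconstruction of `G`. -/
structure IsDeconstruction (G H : Graph) (B : H.V → Set G.V) : Prop where
  coverage : ∀ g g' : G.V, ReflAdj G.graph g g' →
    ∃ h h' : H.V, ReflAdj H.graph h h' ∧ ({g, g'} : Set G.V) ⊆ B h ∪ B h'
  connectivity : ∀ g : G.V, (H.graph.induce {h | g ∈ B h}).Connected

/-- The width of a deconstruction: the maximum size of `B h ∪ B h'` over `(h, h') ∈ refl(E)`. -/
noncomputable def deconstructionWidth (G H : Graph) (B : H.V → Set G.V) : ℕ∞ :=
  ⨆ (h : H.V) (h' : H.V) (_ : ReflAdj H.graph h h'), (B h ∪ B h').encard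

/-- `𝒢 ⪯ ℋ`: for some `k ≥ 1`, each graph in `𝒢` has a deconstruction of width at most `k` with
respect to some graph in `ℋ`. -/
def Prec (𝒢 ℋ : Set Graph) : Prop :=
  ∃ k : ℕ, 1 ≤ k ∧ ∀ G ∈ 𝒢, ∃ H ∈ ℋ, ∃ B : H.V → Set G.V,
    IsDeconstruction G H B ∧ deconstructionWidth G H B ≤ k

/-! ### Minors and stack depth -/

/-- `μ` is a minor map from `M` to `G` (connected subgraphs are nonempty in Mathlib). -/
structure IsMinorMap (M G : Graph) (μ : M.V → Set G.V) : Prop where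
  connected : ∀ m, (G.graph.induce (μ m)).Connected
  disjoint : ∀ m m', m ≠ m' → Disjoint (μ m) (μ m')
  edge : ∀ m m', M.graph.Adj m m' → ∃ g ∈ μ m, ∃ g' ∈ μ m', G.graph.Adj g g'

/-- The class of all minors of graphs in `𝒢`. -/
def minors (𝒢 : Set Graph) : Set Graph :=
  {M | ∃ G ∈ 𝒢, ∃ μ : M.V → Set G.V, IsMinorMap M G μ}

/-- The tree `T_{h,k}`: its vertices are the strings of length at most `h` over an alphabet with
`k` letters, and each string `t` is adjacent to its one-letter extensions `ti`. -/
def fullTree (h k : ℕ) : Graph where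
  V := {t : List (Fin k) // t.length ≤ h}
  finite := List.finite_length_le (Fin k) h
  nonempty := ⟨⟨[], Nat.zero_le h⟩⟩
  graph :=
    { Adj := fun s t => (∃ i, t.1 = s.1 ++ [i]) ∨ (∃ i, s.1 = t.1 ++ [i])
      symm := ⟨fun _ _ hst => hst.symm⟩
      loopless := ⟨fun s hs => by
        rcases hs with ⟨i, hi⟩ | ⟨i, hi⟩ <;> simp at hi⟩ }

/-- The stack depth of a class of graphs: the maximum `h` such that all trees `T_{h,k}`, `k ≥ 1`,
are minors of graphs in the class (`∞` if there are infinitely many such `h`). -/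
noncomputable def stackDepth (𝒢 : Set Graph) : ℕ∞ :=
  ⨆ (h : ℕ) (_ : ∀ k : ℕ, 1 ≤ k → fullTree h k ∈ minors 𝒢), (h : ℕ∞)

/-! ## Pebble games -/

/-- A partial homomorphism from `A` to `B`: either the empty map or a homomorphism to `B` from the
structure induced in `A` on its domain (so nullary relations impose nothing on the empty map). -/
structure PartialHom {σ : Vocabulary} (A B : Str σ) where
  dom : Set A.carrier
  toFun : dom → B.carrier
  map_rel : dom.Nonempty → ∀ {n : ℕ} (R : σ.lang.Relations n) (x : Fin n → dom),
    FirstOrder.Language.Structure.RelMap R (fun i => (x i : A.carrier)) →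
      FirstOrder.Language.Structure.RelMap R (fun i => toFun (x i))

/-- `g'` extends `g`. -/
def PartialHom.Extends {σ : Vocabulary} {A B : Str σ} (g' g : PartialHom A B) : Prop :=
  ∀ (a : A.carrier) (ha : a ∈ g.dom), ∃ ha' : a ∈ g'.dom, g'.toFun ⟨a, ha'⟩ = g.toFun ⟨a, ha⟩

/-- A game vector with `r + 1` rounds is a tuple `v : Fin (r + 1) → ℕ`. The sequence `W` is a
Duplicator winning strategy for the `v`-game on `(A, B)`. -/
structure IsDuplicatorStrategy {σ : Vocabulary} {r : ℕ} (v : Fin (r + 1) → ℕ) (A B : Str σ)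
    (W : Fin (r + 1) → Set (PartialHom A B)) : Prop where
  first : ∀ S : Set A.carrier, S.encard ≤ v 0 → ∃ g ∈ W 0, g.dom = S
  step : ∀ (i : Fin r), ∀ g ∈ W i.castSucc, ∀ S : Set A.carrier, g.dom ⊆ S →
    (S \ g.dom).encard ≤ v i.succ → ∃ g' ∈ W i.succ, g'.Extends g ∧ g'.dom = S

/-- The `v`-game solves `HOM(A)`. -/
def SolvesHom {σ : Vocabulary} {r : ℕ} (v : Fin (r + 1) → ℕ) (A : Str σ) : Prop :=
  ∀ B : Str σ, (∃ W, IsDuplicatorStrategy v A B W) → HomTo A B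

/-- The `v`-game solves `p-HOM(𝒜)`. -/
def SolvesPHom {r : ℕ} (v : Fin (r + 1) → ℕ) (𝒜 : Set (Σ σ : Vocabulary, Str σ)) : Prop :=
  ∀ A ∈ 𝒜, SolvesHom v A.2

end HomGame

/-!
All three conditions are compared with the existence of codings. A coding of depth `ℓ` and width `k`
of a graph (`HasCoding`) places its vertices at the nodes of a rooted forest with `ℓ` levels, at
most `k` vertices at each node, such that adjacent vertices are placed on a common branch. The
nodes are represented by lists, with the tail of a list as its parent, so that the ancestor relation
becomes the suffix relation. The theorem says that each of its conditions is equivalent to the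
cores having codings of depth `r + 1` and bounded width.

*Games.* If the cores have codings, Spoiler wins whenever there is no homomorphism by playing along
the branches of the forest: Duplicator's answers on all branches fit together to a homomorphism
(`solvesHom_of_hasCoding`). Conversely, Duplicator wins the game from `A` to the unravelling of `A`
along the possible plays, whose graph has a coding by construction. If the game solves the
homomorphism problem, there is a homomorphism from `A` to its unravelling, and since the unravelling
maps back to `A`, the core of `A` embeds into it and inherits the coding
(`hasCoding_of_solvesHom`).

*Deconstructions.* Given a deconstruction over a forest, a vertex is placed at the topmost node
whose bag contains it (`hasCoding_of_isDeconstruction`). Given a coding, the bag of a node consists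
of the vertices placed at its ancestors (`exists_isDeconstruction_of_hasCoding`).

*Tree depth and stack depth.* A coding bounds the tree depth, as the vertices at a node can be put
one below the other (`treeDepth_le_of_hasCoding`). For the rest it is convenient to reformulate
codings as elimination procedures: there are `ℓ` rounds, and in each round at most `k` vertices are
removed from each connected set that is left (`Elim`). If the branching of a tree exceeds `k`, a
round lowers the height of a minor model of the tree by at most one, so a tree of height `h` needs
`h + 1` rounds (`TreeModel.height_lt_of_elim`). Conversely, let the tree depth be bounded and the
tree of height `h + 1` be excluded as a minor of a connected graph. Then boundedly many vertices
meet all models of the tree of height `h` with one more child per node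
(`exists_encard_le_forall_not_treeModel`), by induction on the tree depth: after the removal of the
root of an elimination tree, few of the components contain such models, because these could be
rerooted next to the removed vertex and combined to a model of height `h + 1`. Repeating this for
smaller and smaller heights gives the elimination procedure
(`exists_elim_of_forall_not_treeModel`).
-/

namespace HomGame

open FirstOrder FirstOrder.Language

/-! ### Connected vertex sets -/

section ConnectedSets

variable {V : Type} {G : SimpleGraph V}

/-- The vertex set `X` induces a connected (in particular nonempty) subgraph of `G`. -/
abbrev Conn (G : SimpleGraph V) (X : Set V) : Prop := (G.induce X).Connected

theorem Conn.nonempty {X : Set V} (hX : Conn G X) : X.Nonempty := by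
  obtain ⟨x⟩ := SimpleGraph.Connected.nonempty hX
  exact ⟨x.1, x.2⟩

theorem conn_singleton (v : V) : Conn G {v} := by
  have : Subsingleton ({v} : Set V) := Set.subsingleton_singleton.coe_sort
  have : Nonempty ({v} : Set V) := ⟨⟨v, rfl⟩⟩
  exact ⟨SimpleGraph.Preconnected.of_subsingleton⟩

theorem Conn.induction {X : Set V} (hX : Conn G X) {P : V → Prop} {a : V} (ha : a ∈ X) (hPa : P a)
    (step : ∀ u ∈ X, ∀ v ∈ X, G.Adj u v → P u → P v) : ∀ v ∈ X, P v := by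
  intro v hv
  obtain ⟨p⟩ := hX.preconnected ⟨a, ha⟩ ⟨v, hv⟩
  have key : ∀ (x y : X), (G.induce X).Walk x y → P x.1 → P y.1 := by
    intro x y q
    induction q with
    | nil => exact id
    | cons h _ ih => exact fun hx => ih (step _ (Subtype.prop _) _ (Subtype.prop _) h hx)
  exact key _ _ p hPa

theorem Conn.union_of_adj {X Y : Set V} (hX : Conn G X) (hY : Conn G Y) {a b : V}
    (ha : a ∈ X) (hb : b ∈ Y) (hab : G.Adj a b) : Conn G (X ∪ Y) :=
  SimpleGraph.connected_induce_union hX.preconnected hY.preconnected ha hb hab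

theorem Conn.union {X Y : Set V} (hX : Conn G X) (hY : Conn G Y) {a : V}
    (ha : a ∈ X) (hb : a ∈ Y) : Conn G (X ∪ Y) :=
  SimpleGraph.induce_union_connected hX.preconnected hY.preconnected ⟨a, ha, hb⟩

theorem conn_sUnion {S : Set (Set V)} {a : V} (hS : S.Nonempty) (h : ∀ C ∈ S, Conn G C ∧ a ∈ C) :
    Conn G (⋃₀ S) :=
  SimpleGraph.induce_sUnion_connected_of_pairwise_not_disjoint hS
    (fun {_ _} hs ht => ⟨a, (h _ hs).2, (h _ ht).2⟩) (fun {_} hs => (h _ hs).1)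

theorem Conn.exists_adj_diff {X C : Set V} (hX : Conn G X) {a b : V} (haC : a ∈ C) (haX : a ∈ X)
    (hbX : b ∈ X) (hbC : b ∉ C) : ∃ u ∈ X ∩ C, ∃ v ∈ X \ C, G.Adj u v := by
  by_contra! hcon
  refine hbC (hX.induction (P := fun v => v ∈ C) haX haC ?_ b hbX)
  intro u hu v hv huv huC
  by_contra hvC
  exact hcon u ⟨hu, huC⟩ v ⟨hv, hvC⟩ huv

/-- The connected component of `a` in the subgraph induced on `X` (empty if `a ∉ X`), as the union
of all connected subsets of `X` that contain `a`. -/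
def comp (G : SimpleGraph V) (X : Set V) (a : V) : Set V :=
  ⋃₀ {C | C ⊆ X ∧ Conn G C ∧ a ∈ C}

theorem comp_subset (X : Set V) (a : V) : comp G X a ⊆ X :=
  Set.sUnion_subset fun _ hC => hC.1

theorem subset_comp {X C : Set V} {a : V} (hCX : C ⊆ X) (hC : Conn G C) (ha : a ∈ C) :
    C ⊆ comp G X a :=
  Set.subset_sUnion_of_mem (S := {C | C ⊆ X ∧ Conn G C ∧ a ∈ C}) ⟨hCX, hC, ha⟩

theorem mem_comp {X : Set V} {a : V} (ha : a ∈ X) : a ∈ comp G X a :=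
  subset_comp (Set.singleton_subset_iff.2 ha) (conn_singleton a) rfl rfl

theorem conn_comp {X : Set V} {a : V} (ha : a ∈ X) : Conn G (comp G X a) :=
  conn_sUnion ⟨{a}, Set.singleton_subset_iff.2 ha, conn_singleton a, rfl⟩ fun _ hC => hC.2

theorem comp_eq_of_mem {X : Set V} {a b : V} (ha : a ∈ X) (hb : b ∈ comp G X a) :
    comp G X b = comp G X a := by
  have h1 : comp G X a ⊆ comp G X b := subset_comp (comp_subset X a) (conn_comp ha) hb
  have hbX := comp_subset X a hb
  exact (subset_comp (comp_subset X b) (conn_comp hbX) (h1 (mem_comp ha))).antisymm h1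

theorem comp_eq_of_adj {X : Set V} {a b : V} (ha : a ∈ X) (hb : b ∈ X) (hab : G.Adj a b) :
    comp G X b = comp G X a := by
  refine comp_eq_of_mem ha ?_
  have : Conn G ({a} ∪ {b}) := (conn_singleton a).union_of_adj (conn_singleton b) rfl rfl hab
  exact subset_comp (by simp [Set.insert_subset_iff, ha, hb]) this (Or.inl rfl) (Or.inr rfl)

/-- Inside a connected set, every vertex can be joined to a set `Z` by a connected set that meets
`Z` in a single vertex, namely an initial segment of a path leading to `Z`. -/
theorem Conn.exists_conn_inter_singleton {X Z : Set V} (hX : Conn G X) {a : V} (ha : a ∈ X)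
    {b : V} (hbX : b ∈ X) (hbZ : b ∈ Z) :
    ∃ D z, Conn G D ∧ a ∈ D ∧ D ⊆ X ∧ D ∩ Z = {z} := by
  refine hX.induction (P := fun a => ∃ D z, Conn G D ∧ a ∈ D ∧ D ⊆ X ∧ D ∩ Z = {z}) hbX
    ⟨{b}, b, conn_singleton b, rfl, Set.singleton_subset_iff.2 hbX, ?_⟩ ?_ a ha
  · simpa using hbZ
  · rintro u hu v hv huv ⟨D, z, hD, huD, hDX, hDZ⟩
    by_cases hvZ : v ∈ Z
    · exact ⟨{v}, v, conn_singleton v, rfl, Set.singleton_subset_iff.2 hv, by simpa using hvZ⟩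
    · refine ⟨{v} ∪ D, z, (conn_singleton v).union_of_adj hD rfl huD huv.symm, Or.inl rfl,
        Set.union_subset (Set.singleton_subset_iff.2 hv) hDX, ?_⟩
      rw [Set.union_inter_distrib_right, hDZ, Set.singleton_inter_eq_empty.2 hvZ, Set.empty_union]

/-- If adjacent vertices have comparable codes, a connected set has a vertex whose code is a suffix
of all codes in the set: any vertex with a code of minimal length. -/
theorem Conn.exists_suffix {α : Type} {X : Set V} (hX : Conn G X) (f : V → List α)
    (hf : ∀ u ∈ X, ∀ v ∈ X, G.Adj u v → f u <:+ f v ∨ f v <:+ f u) :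
    ∃ u ∈ X, ∀ v ∈ X, f u <:+ f v := by
  obtain ⟨u, hu, hmin⟩ : ∃ u ∈ X, ∀ v ∈ X, (f u).length ≤ (f v).length := by
    have hne := hX.nonempty
    refine ⟨Function.argminOn (fun v => (f v).length) X hne, Function.argminOn_mem _ _ _, ?_⟩
    intro v hv
    exact Function.argminOn_le (fun v => (f v).length) X hv
  refine ⟨u, hu, hX.induction hu List.suffix_rfl ?_⟩
  intro v hv w hw hvw huv
  rcases hf v hv w hw hvw with h | h
  · exact huv.trans h
  · rcases List.suffix_or_suffix_of_suffix huv h with h' | h'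
    · exact h'
    · rw [h'.eq_of_length (le_antisymm h'.length_le (hmin w hw))]

end ConnectedSets

/-! ### Codings and elimination -/

section Coding

variable {V : Type} {G : SimpleGraph V}

/-- A coding of the subgraph induced on `X` of depth `ℓ` and width `k`. The lists are the nodes of a
forest in which the parent of `x :: t` is `t`, so `f` places the vertices at the nodes of a forest
with at most `ℓ` levels, at most `k` at each node, such that adjacent vertices sit at nodes on a
common branch. -/
structure IsCoding {α : Type} (G : SimpleGraph V) (X : Set V) (ℓ k : ℕ) (f : V → List α) :
    Prop where
  ne_nil : ∀ v ∈ X, f v ≠ []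
  length_le : ∀ v ∈ X, (f v).length ≤ ℓ
  encard_le : ∀ t, {v ∈ X | f v = t}.encard ≤ k
  comparable : ∀ u ∈ X, ∀ v ∈ X, G.Adj u v → f u <:+ f v ∨ f v <:+ f u

/-- `G` has a coding of depth `ℓ` and width `k` over a finite alphabet. -/
def HasCoding (G : SimpleGraph V) (ℓ k : ℕ) : Prop :=
  ∃ (α : Type) (_ : Finite α) (f : V → List α), IsCoding G Set.univ ℓ k f

/-- `X` can be exhausted in `ℓ` rounds, where in each round at most `k` vertices are removed from
every connected set that is left. -/
def Elim (G : SimpleGraph V) (k : ℕ) : ℕ → Set V → Prop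
  | 0, X => X = ∅
  | ℓ + 1, X => ∀ C ⊆ X, Conn G C → ∃ S : Set V, S.encard ≤ k ∧ Elim G k ℓ (C \ S)

theorem Elim.mono {k ℓ : ℕ} {X Y : Set V} (h : Elim G k ℓ X) (hYX : Y ⊆ X) : Elim G k ℓ Y := by
  cases ℓ with
  | zero => exact Set.subset_eq_empty hYX h
  | succ ℓ => exact fun C hC => h C (hC.trans hYX)

theorem Elim.mono_width {k k' : ℕ} (hk : k ≤ k') {ℓ : ℕ} {X : Set V} (h : Elim G k ℓ X) :
    Elim G k' ℓ X := by
  induction ℓ generalizing X with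
  | zero => exact h
  | succ ℓ ih =>
    intro C hCX hC
    obtain ⟨S, hS, hE⟩ := h C hCX hC
    exact ⟨S, hS.trans (by exact_mod_cast hk), ih hE⟩

/-- The vertices removed from a connected set are those sharing the topmost code. -/
theorem IsCoding.elim {α : Type} {f : V → List α} {Y : Set V} {m k : ℕ} (hf : IsCoding G Y m k f)
    {ℓ : ℕ} {X : Set V} (t : List α) (hXY : X ⊆ Y)
    (h : ∀ v ∈ X, t <:+ f v ∧ t ≠ f v ∧ (f v).length ≤ t.length + ℓ) : Elim G k ℓ X := by
  induction ℓ generalizing X t with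
  | zero =>
    refine Set.eq_empty_of_forall_notMem fun v hv => ?_
    obtain ⟨h1, h2, h3⟩ := h v hv
    exact h2 (h1.eq_of_length (le_antisymm h1.length_le h3))
  | succ ℓ ih =>
    intro C hCX hC
    obtain ⟨u, hu, htop⟩ := hC.exists_suffix f
      fun u hu v hv => hf.comparable u (hXY (hCX hu)) v (hXY (hCX hv))
    refine ⟨{v ∈ Y | f v = f u}, hf.encard_le _, ih (f u) (fun v hv => hXY (hCX hv.1)) ?_⟩
    rintro v ⟨hvC, hvS⟩
    refine ⟨htop v hvC, fun he => hvS ⟨hXY (hCX hvC), he.symm⟩, ?_⟩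
    obtain ⟨h1, h2, -⟩ := h u (hCX hu)
    have h3 := (h v (hCX hvC)).2.2
    have h4 : t.length < (f u).length :=
      lt_of_le_of_ne h1.length_le fun he => h2 (h1.eq_of_length he)
    lia

theorem HasCoding.elim {ℓ k : ℕ} (h : HasCoding G ℓ k) : Elim G k ℓ Set.univ := by
  obtain ⟨α, -, f, hf⟩ := h
  exact hf.elim [] subset_rfl fun v hv =>
    ⟨List.nil_suffix, (hf.ne_nil v hv).symm, by simpa using hf.length_le v hv⟩

/-- The component in which a vertex is found in each round serves as a letter of its code. -/
theorem Elim.exists_isCoding {k ℓ : ℕ} {X : Set V} (h : Elim G k ℓ X) :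
    ∃ f : V → List (Set V), IsCoding G X ℓ k f := by
  classical
  induction ℓ generalizing X with
  | zero =>
    obtain rfl : X = ∅ := h
    exact ⟨fun _ => [], by simp, by simp, by simp, by simp⟩
  | succ ℓ ih =>
    have h' : ∀ C : Set V, ∃ (S : Set V) (f : V → List (Set V)), C ⊆ X → Conn G C →
        S.encard ≤ k ∧ IsCoding G (C \ S) ℓ k f := by
      intro C
      by_cases hC : C ⊆ X ∧ Conn G C
      · obtain ⟨S, hS, hE⟩ := h C hC.1 hC.2
        obtain ⟨f, hf⟩ := ih hE
        exact ⟨S, f, fun _ _ => ⟨hS, hf⟩⟩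
      · exact ⟨∅, fun _ => [], fun h1 h2 => absurd ⟨h1, h2⟩ hC⟩
    choose S g hSg using h'
    let c : V → Set V := comp G X
    have hS : ∀ u ∈ X, (S (c u)).encard ≤ k := fun u hu =>
      (hSg (c u) (comp_subset X u) (conn_comp hu)).1
    have hg : ∀ u ∈ X, IsCoding G (c u \ S (c u)) ℓ k (g (c u)) := fun u hu =>
      (hSg (c u) (comp_subset X u) (conn_comp hu)).2
    let f : V → List (Set V) := fun u => if u ∈ S (c u) then [c u] else g (c u) u ++ [c u]
    have f_pos : ∀ u, u ∈ S (c u) → f u = [c u] := fun u hu => if_pos hu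
    have f_neg : ∀ u, u ∉ S (c u) → f u = g (c u) u ++ [c u] := fun u hu => if_neg hu
    have f_last : ∀ u, ∃ t, f u = t ++ [c u] := by
      intro u
      by_cases hu : u ∈ S (c u)
      · exact ⟨[], f_pos u hu⟩
      · exact ⟨_, f_neg u hu⟩
    refine ⟨f, ?_, ?_, ?_, ?_⟩
    · intro v _ hv
      obtain ⟨t, ht⟩ := f_last v
      simp [ht] at hv
    · intro v hv
      by_cases hvS : v ∈ S (c v)
      · simp [f_pos v hvS]
      · simpa [f_neg v hvS] using (hg v hv).length_le v ⟨mem_comp hv, hvS⟩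
    · intro t
      by_cases hex : ∃ u ∈ X, f u = t
      swap
      · have : {v ∈ X | f v = t} = ∅ :=
          Set.eq_empty_of_forall_notMem fun v hv => hex ⟨v, hv.1, hv.2⟩
        simp [this]
      obtain ⟨u, hu, rfl⟩ := hex
      have hc : ∀ v, f v = f u → c v = c u := by
        intro v hv
        obtain ⟨t, ht⟩ := f_last v
        obtain ⟨t', ht'⟩ := f_last u
        rw [ht, ht'] at hv
        simpa using (List.append_inj' hv rfl).2
      have hmem : ∀ v ∈ X, f v = f u → v ∈ c u := fun v hv h => hc v h ▸ mem_comp hv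
      by_cases huS : u ∈ S (c u)
      · refine le_trans (Set.encard_le_encard ?_) (hS u hu)
        rintro v ⟨hv, hvu⟩
        by_contra hvS
        have hcv := hc v hvu
        have hvm := hmem v hv hvu
        rw [f_neg v (hcv ▸ hvS), f_pos u huS, hcv] at hvu
        exact (hg u hu).ne_nil v ⟨hvm, hvS⟩ (by simpa using hvu)
      · refine le_trans (Set.encard_le_encard ?_) ((hg u hu).encard_le (g (c u) u))
        rintro v ⟨hv, hvu⟩
        have hcv := hc v hvu
        have hvS : v ∉ S (c u) := by
          intro hvS
          rw [f_pos v (hcv ▸ hvS), f_neg u huS, hcv] at hvu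
          exact (hg u hu).ne_nil u ⟨mem_comp hu, huS⟩ (by simpa using hvu)
        refine ⟨⟨hmem v hv hvu, hvS⟩, ?_⟩
        rw [f_neg v (hcv ▸ hvS), f_neg u huS, hcv] at hvu
        exact List.append_cancel_right hvu
    · intro u hu v hv huv
      have hc : c v = c u := comp_eq_of_adj hu hv huv
      by_cases huS : u ∈ S (c u)
      · left
        obtain ⟨t, ht⟩ := f_last v
        rw [f_pos u huS, ht, hc]
        exact List.suffix_append _ _
      · by_cases hvS : v ∈ S (c u)
        · right
          rw [f_pos v (hc ▸ hvS), f_neg u huS, hc]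
          exact List.suffix_append _ _
        · rw [f_neg u huS, f_neg v (hc ▸ hvS), hc]
          refine ((hg u hu).comparable u ⟨mem_comp hu, huS⟩ v ⟨hc ▸ mem_comp hv, hvS⟩ huv).imp ?_ ?_
          · rintro ⟨s, hs⟩
            exact ⟨s, by rw [← hs, List.append_assoc]⟩
          · rintro ⟨s, hs⟩
            exact ⟨s, by rw [← hs, List.append_assoc]⟩

theorem Elim.hasCoding [Finite V] {k ℓ : ℕ} (h : Elim G k ℓ Set.univ) : HasCoding G ℓ k := by
  obtain ⟨f, hf⟩ := h.exists_isCoding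
  exact ⟨Set V, inferInstance, f, hf⟩

end Coding

/-! ### Minor models of full trees -/

section TreeModels

variable {V : Type} {G : SimpleGraph V}

/-- The connected set `X` contains a minor model of the tree of height `h` and branching `n` in
which the branch set of the root is `R`; the sets `Y i` contain the models of the subtrees below
the children of the root. The vertices of `X` need not all belong to branch sets. -/
def TreeModel (G : SimpleGraph V) : ℕ → ℕ → Set V → Set V → Prop
  | 0, _, X, R => Conn G X ∧ Conn G R ∧ R ⊆ X
  | h + 1, n, X, R => Conn G X ∧ Conn G R ∧ R ⊆ X ∧ ∃ Y Q : Fin n → Set V,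
      (∀ i, TreeModel G h n (Y i) (Q i)) ∧ (∀ i, Y i ⊆ X \ R) ∧
      (∀ i j, i ≠ j → Disjoint (Y i) (Y j)) ∧ ∀ i, ∃ a ∈ R, ∃ b ∈ Q i, G.Adj a b

theorem TreeModel.conn {h n : ℕ} {X R : Set V} (hM : TreeModel G h n X R) : Conn G X := by
  cases h <;> exact hM.1

theorem TreeModel.root_subset {h n : ℕ} {X R : Set V} (hM : TreeModel G h n X R) : R ⊆ X := by
  cases h
  · exact hM.2.2
  · exact hM.2.2.1

theorem TreeModel.mono {h n : ℕ} {X X' R : Set V} (hM : TreeModel G h n X R) (hX : X ⊆ X')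
    (hX' : Conn G X') : TreeModel G h n X' R := by
  cases h with
  | zero => exact ⟨hX', hM.2.1, hM.2.2.trans hX⟩
  | succ h =>
    obtain ⟨-, hR, hRX, Y, Q, hY, hYX, hdisj, hadj⟩ := hM
    exact ⟨hX', hR, hRX.trans hX, Y, Q, hY, fun i => (hYX i).trans (Set.sdiff_subset_sdiff_left hX),
      hdisj, hadj⟩

theorem TreeModel.mono_branching {h n n' : ℕ} {X R : Set V} (hM : TreeModel G h n' X R)
    (hn : n ≤ n') : TreeModel G h n X R := by
  induction h generalizing X R with
  | zero => exact hM
  | succ h ih =>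
    obtain ⟨hX, hR, hRX, Y, Q, hY, hYX, hdisj, hadj⟩ := hM
    exact ⟨hX, hR, hRX, fun i => Y (Fin.castLE hn i), fun i => Q (Fin.castLE hn i),
      fun i => ih (hY _), fun i => hYX _,
      fun i j hij => hdisj _ _ fun he => hij (Fin.castLE_injective hn he), fun i => hadj _⟩

/-- The `k` vertices removed from the connected set of the model miss one of the `n > k` subtrees
below the root, so a round lowers the height by at most one. -/
theorem TreeModel.height_lt_of_elim {k n : ℕ} (hkn : k < n) {ℓ h : ℕ} {X Y R : Set V}
    (hE : Elim G k ℓ X) (hM : TreeModel G h n Y R) (hYX : Y ⊆ X) : h < ℓ := by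
  induction ℓ generalizing h X Y R with
  | zero =>
    obtain ⟨y, hy⟩ := hM.conn.nonempty
    obtain rfl : X = ∅ := hE
    exact (hYX hy).elim
  | succ ℓ ih =>
    cases h with
    | zero => exact Nat.succ_pos _
    | succ h =>
      obtain ⟨S, hS, hE'⟩ := hE Y hYX hM.conn
      obtain ⟨-, -, -, Z, Q, hZ, hZY, hdisj, -⟩ := hM
      obtain ⟨i, hi⟩ : ∃ i, Disjoint (Z i) S := by
        by_contra! hcon
        have hcon' : ∀ i, ∃ s, s ∈ Z i ∧ s ∈ S := fun i => Set.not_disjoint_iff.1 (hcon i)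
        choose s hsZ hsS using hcon'
        have hinj : Function.Injective s := by
          intro i j hij
          by_contra hne
          exact Set.disjoint_left.1 (hdisj i j hne) (hsZ i) (hij ▸ hsZ j)
        have h1 : (Set.range s).encard ≤ S.encard :=
          Set.encard_le_encard (Set.range_subset_iff.2 hsS)
        rw [← Set.image_univ, hinj.encard_image, Set.encard_univ, ENat.card_eq_coe_natCard,
          Nat.card_fin] at h1
        have h2 : (n : ℕ∞) ≤ k := h1.trans hS
        exact absurd (by exact_mod_cast h2) (not_le.2 hkn)
      have := ih hE' (hZ i) fun z hz =>
        ⟨(hZY i hz).1, fun hzS => Set.disjoint_left.1 hi hz hzS⟩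
      lia

/-- At the cost of one child per node, the root branch set can be made to contain any prescribed
vertex: a connected set from that vertex to the model is added to it, together with the subtree
below the child in which that set first meets the model. -/
theorem TreeModel.reroot {h n : ℕ} {X R : Set V} (hM : TreeModel G h (n + 1) X R) {a : V}
    (ha : a ∈ X) : ∃ R', a ∈ R' ∧ TreeModel G h n X R' := by
  cases h with
  | zero => exact ⟨X, ha, hM.1, hM.1, subset_rfl⟩
  | succ h =>
    obtain ⟨hX, hR, hRX, Y, Q, hY, hYX, hdisj, hadj⟩ := hM
    obtain ⟨b, hb⟩ := hR.nonempty
    obtain ⟨D, z, hD, haD, hDX, hDZ⟩ :=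
      hX.exists_conn_inter_singleton ha (hRX hb) (Z := R ∪ ⋃ i, Y i) (Or.inl hb)
    have hz : z ∈ D ∩ (R ∪ ⋃ i, Y i) := by rw [hDZ]; rfl
    have hDY : ∀ i, ∀ y ∈ Y i, y ∈ D → y = z := by
      intro i y hy hyD
      have : y ∈ D ∩ (R ∪ ⋃ i, Y i) := ⟨hyD, Or.inr (Set.mem_iUnion.2 ⟨i, hy⟩)⟩
      rwa [hDZ] at this
    rcases hz with ⟨hzD, hzR | hzY⟩
    · refine ⟨R ∪ D, Or.inr haD, hX, hR.union hD hzR hzD, Set.union_subset hRX hDX,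
        fun i => Y i.castSucc, fun i => Q i.castSucc,
        fun i => (hY _).mono_branching (Nat.le_succ n), ?_, ?_, ?_⟩
      · intro i y hy
        refine ⟨(hYX _ hy).1, ?_⟩
        rintro (hyR | hyD)
        · exact (hYX _ hy).2 hyR
        · exact (hYX _ hy).2 (hDY _ y hy hyD ▸ hzR)
      · exact fun i j hij => hdisj _ _ fun he => hij (Fin.castSucc_injective n he)
      · intro i
        obtain ⟨u, hu, w, hw, huw⟩ := hadj i.castSucc
        exact ⟨u, Or.inl hu, w, hw, huw⟩
    · obtain ⟨j, hzj⟩ := Set.mem_iUnion.1 hzY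
      obtain ⟨u, hu, w, hw, huw⟩ := hadj j
      refine ⟨R ∪ Y j ∪ D, Or.inr haD, hX,
        (hR.union_of_adj (hY j).conn hu ((hY j).root_subset hw) huw).union hD (Or.inr hzj) hzD,
        Set.union_subset (Set.union_subset hRX fun y hy => (hYX j hy).1) hDX,
        fun i => Y (j.succAbove i), fun i => Q (j.succAbove i),
        fun i => (hY _).mono_branching (Nat.le_succ n), ?_, ?_, ?_⟩
      · intro i y hy
        have hyj : y ∉ Y j := Set.disjoint_left.1 (hdisj _ _ (Fin.succAbove_ne j i)) hy
        refine ⟨(hYX _ hy).1, ?_⟩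
        rintro ((hyR | hyY) | hyD)
        · exact (hYX _ hy).2 hyR
        · exact hyj hyY
        · exact hyj (hDY _ y hy hyD ▸ hzj)
      · exact fun i i' hii' => hdisj _ _ fun he => hii' (Fin.succAbove_right_injective he)
      · intro i
        obtain ⟨u, hu, w, hw, huw⟩ := hadj (j.succAbove i)
        exact ⟨u, Or.inl (Or.inl hu), w, hw, huw⟩

/-- A family of branch sets, indexed by the strings of length at most `h`, that form a minor model
of the full tree; `(s, i)` ranges over its edges. -/
structure IsListModel (G : SimpleGraph V) (h n : ℕ) (μ : List (Fin n) → Set V) : Prop where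
  conn : ∀ s, s.length ≤ h → Conn G (μ s)
  disjoint : ∀ s t, s.length ≤ h → t.length ≤ h → s ≠ t → Disjoint (μ s) (μ t)
  edge : ∀ s i, s.length + 1 ≤ h → ∃ a ∈ μ s, ∃ b ∈ μ (s ++ [i]), G.Adj a b

theorem TreeModel.exists_isListModel {h n : ℕ} {X R : Set V} (hM : TreeModel G h n X R) :
    ∃ μ, IsListModel G h n μ ∧ μ [] = R ∧ ∀ s, s.length ≤ h → μ s ⊆ X := by
  induction h generalizing X R with
  | zero =>
    refine ⟨fun _ => R, ⟨fun _ _ => hM.2.1, ?_, ?_⟩, rfl, fun _ _ => hM.2.2⟩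
    · intro s t hs ht hst
      rw [Nat.le_zero, List.length_eq_zero_iff] at hs ht
      exact absurd (hs.trans ht.symm) hst
    · intro s i hs
      exact absurd hs (Nat.not_succ_le_zero _)
  | succ h ih =>
    obtain ⟨hX, hR, hRX, Y, Q, hY, hYX, hdisj, hadj⟩ := hM
    choose ν hν hνQ hνY using fun i => ih (hY i)
    let μ : List (Fin n) → Set V
      | [] => R
      | i :: s => ν i s
    have hRν : ∀ i s, s.length ≤ h → Disjoint R (ν i s) := fun i s hs =>
      Set.disjoint_right.2 fun y hy => (hYX i (hνY i s hs hy)).2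
    refine ⟨μ, ⟨?_, ?_, ?_⟩, rfl, ?_⟩
    · rintro (_ | ⟨i, s⟩) hs
      · exact hR
      · exact (hν i).conn s (by simpa using hs)
    · rintro (_ | ⟨i, s⟩) (_ | ⟨j, t⟩) hs ht hst
      · exact absurd rfl hst
      · exact hRν j t (by simpa using ht)
      · exact (hRν i s (by simpa using hs)).symm
      · have hs' : s.length ≤ h := by simpa using hs
        have ht' : t.length ≤ h := by simpa using ht
        by_cases hij : i = j
        · subst hij
          exact (hν i).disjoint s t hs' ht' fun he => hst (he ▸ rfl)
        · exact (hdisj i j hij).mono (hνY i s hs') (hνY j t ht')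
    · rintro (_ | ⟨j, s⟩) i hs
      · obtain ⟨a, ha, b, hb, hab⟩ := hadj i
        exact ⟨a, ha, b, show b ∈ ν i [] from (hνQ i).symm ▸ hb, hab⟩
      · exact (hν j).edge s i (by simpa using hs)
    · rintro (_ | ⟨i, s⟩) hs
      · exact hRX
      · exact fun y hy => (hYX i (hνY i s (by simpa using hs) hy)).1

theorem IsListModel.treeModel {h n : ℕ} {μ : List (Fin n) → Set V} (hμ : IsListModel G h n μ) :
    TreeModel G h n (⋃ (s) (_ : s.length ≤ h), μ s) (μ []) := by
  induction h generalizing μ with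
  | zero =>
    have : (⋃ (s : List (Fin n)) (_ : s.length ≤ 0), μ s) = μ [] := by
      ext v
      simp
    rw [this]
    exact ⟨hμ.conn [] le_rfl, hμ.conn [] le_rfl, subset_rfl⟩
  | succ h ih =>
    have hi : ∀ i, IsListModel G h n fun s => μ (i :: s) := fun i =>
      ⟨fun s hs => hμ.conn _ (by simpa using hs),
        fun s t hs ht hst => hμ.disjoint _ _ (by simpa using hs) (by simpa using ht)
          fun he => hst (List.cons_injective he),
        fun s j hs => hμ.edge (i :: s) j (by simpa using hs)⟩
    have hR := hμ.conn [] (Nat.zero_le _)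
    have hY := fun i => ih (hi i)
    have hadj : ∀ i, ∃ a ∈ μ [], ∃ b ∈ μ [i], G.Adj a b := fun i => hμ.edge [] i (by simp)
    have hX : (⋃ (s : List (Fin n)) (_ : s.length ≤ h + 1), μ s)
        = ⋃₀ ({μ []} ∪ Set.range fun i => μ [] ∪ ⋃ (s) (_ : s.length ≤ h), μ (i :: s)) := by
      ext v
      simp only [Set.mem_iUnion, Set.mem_sUnion, Set.mem_union, Set.mem_singleton_iff,
        Set.mem_range]
      constructor
      · rintro ⟨_ | ⟨i, s⟩, hs, hv⟩
        · exact ⟨_, Or.inl rfl, hv⟩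
        · exact ⟨_, Or.inr ⟨i, rfl⟩, Or.inr (Set.mem_iUnion₂.2 ⟨s, by simpa using hs, hv⟩)⟩
      · rintro ⟨_, rfl | ⟨i, rfl⟩, hv⟩
        · exact ⟨[], Nat.zero_le _, hv⟩
        · rcases hv with hv | hv
          · exact ⟨[], Nat.zero_le _, hv⟩
          · obtain ⟨s, hs, hv⟩ := Set.mem_iUnion₂.1 hv
            exact ⟨i :: s, by simpa using hs, hv⟩
    obtain ⟨r, hr⟩ := hR.nonempty
    refine ⟨?_, hR, fun v hv => Set.mem_iUnion₂.2 ⟨[], Nat.zero_le _, hv⟩, _, _, hY, ?_, ?_, hadj⟩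
    · rw [hX]
      refine conn_sUnion (a := r) ⟨_, Or.inl rfl⟩ ?_
      rintro _ (rfl | ⟨i, rfl⟩)
      · exact ⟨hR, hr⟩
      · obtain ⟨a, ha, b, hb, hab⟩ := hadj i
        exact ⟨hR.union_of_adj (hY i).conn ha ((hY i).root_subset hb) hab, Or.inl hr⟩
    · intro i v hv
      obtain ⟨s, hs, hv⟩ := Set.mem_iUnion₂.1 hv
      refine ⟨Set.mem_iUnion₂.2 ⟨i :: s, by simpa using hs, hv⟩, fun hvR => ?_⟩
      exact Set.disjoint_left.1
        (hμ.disjoint [] (i :: s) (Nat.zero_le _) (by simpa using hs) (by simp)) hvR hv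
    · intro i j hij
      refine Set.disjoint_left.2 fun v hv hv' => ?_
      obtain ⟨s, hs, hv⟩ := Set.mem_iUnion₂.1 hv
      obtain ⟨t, ht, hv'⟩ := Set.mem_iUnion₂.1 hv'
      exact Set.disjoint_left.1 (hμ.disjoint (i :: s) (j :: t) (by simpa using hs)
        (by simpa using ht) (by simp [hij])) hv hv'

end TreeModels

theorem fullTree_mem_minors_iff {𝒢 : Set Graph} {h n : ℕ} :
    fullTree h n ∈ minors 𝒢 ↔ ∃ G ∈ 𝒢, ∃ X R, TreeModel G.graph h n X R := by
  classical
  constructor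
  · rintro ⟨G, hG, μ, hμ⟩
    let ν : List (Fin n) → Set G.V := fun s => if hs : s.length ≤ h then μ ⟨s, hs⟩ else ∅
    have hν : ∀ s (hs : s.length ≤ h), ν s = μ ⟨s, hs⟩ := fun s hs => dif_pos hs
    refine ⟨G, hG, _, _, IsListModel.treeModel (μ := ν) ⟨?_, ?_, ?_⟩⟩
    · intro s hs
      rw [hν s hs]
      exact hμ.connected _
    · intro s t hs ht hst
      rw [hν s hs, hν t ht]
      exact hμ.disjoint _ _ fun he => hst (congrArg Subtype.val he)
    · intro s i hs
      rw [hν s (by lia), hν (s ++ [i]) (by simpa using hs)]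
      exact hμ.edge _ _ (Or.inl ⟨i, rfl⟩)
  · rintro ⟨G, hG, X, R, hM⟩
    obtain ⟨μ, hμ, -, -⟩ := hM.exists_isListModel
    refine ⟨G, hG, fun s => μ s.1, ?_, ?_, ?_⟩
    · exact fun s => hμ.conn s.1 s.2
    · exact fun s t hst => hμ.disjoint s.1 t.1 s.2 t.2 fun he => hst (Subtype.ext he)
    · rintro ⟨s, hs⟩ ⟨t, ht⟩ (⟨i, hi⟩ | ⟨i, hi⟩)
      · subst hi
        exact hμ.edge s i (by simpa using ht)
      · subst hi
        obtain ⟨a, ha, b, hb, hab⟩ := hμ.edge t i (by simpa using hs)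
        exact ⟨b, hb, a, ha, hab.symm⟩

/-! ### Excluding a tree as a minor -/

/-- If a connected set of bounded tree depth has no model of the tree of height `h + 1`, boundedly
many vertices meet all models of the tree of height `h`. Deleting the root `v` of an elimination
leaves components adjacent to `v`; if `n` of them contained models of height `h`, these could be
rerooted next to `v` and joined by `{v}` to a model of height `h + 1`. So fewer than `n` components
have to be treated, and these have smaller tree depth. -/
theorem exists_encard_le_forall_not_treeModel (h n w : ℕ) :
    ∃ s : ℕ, ∀ {V : Type} [Finite V] (G : SimpleGraph V) (X : Set V), Conn G X → Elim G 1 w X →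
      (∀ R, ¬ TreeModel G (h + 1) n X R) →
      ∃ S : Set V, S.encard ≤ s ∧ ∀ C ⊆ X \ S, ∀ R, ¬ TreeModel G h (n + 1) C R := by
  classical
  induction w with
  | zero =>
    refine ⟨0, fun G X hX hE => ?_⟩
    obtain rfl : X = ∅ := hE
    exact absurd hX.nonempty Set.not_nonempty_empty
  | succ w ih =>
    obtain ⟨s, hs⟩ := ih
    refine ⟨1 + (n + 1) * s, fun {V} _ G X hX hE hno => ?_⟩
    obtain ⟨S₀, hS₀, hE'⟩ := hE X subset_rfl hX
    by_cases hdis : Disjoint X S₀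
    · rw [hdis.sdiff_eq_left] at hE'
      obtain ⟨S, hS, hSC⟩ := hs G X hX hE' hno
      refine ⟨S, hS.trans ?_, hSC⟩
      exact_mod_cast (by nlinarith : s ≤ 1 + (n + 1) * s)
    obtain ⟨v, hvX, hvS⟩ := Set.not_disjoint_iff.1 hdis
    obtain rfl : S₀ = {v} := by
      ext u
      exact ⟨fun hu => Set.encard_le_one_iff.1 (by exact_mod_cast hS₀) u v hu hvS,
        fun hu => hu ▸ hvS⟩
    -- the components of `X \ {v}` that contain a model of height `h`
    let 𝒞 : Set (Set V) := {C | (∃ a ∈ X \ {v}, C = comp G (X \ {v}) a) ∧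
      ∃ R, TreeModel G h (n + 1) C R}
    have hadj : ∀ C ∈ 𝒞, ∃ a ∈ C, G.Adj v a := by
      rintro C ⟨⟨a, ha, rfl⟩, -⟩
      obtain ⟨u, hu, u', hu', huu'⟩ := hX.exists_adj_diff (mem_comp ha) ha.1 hvX
        fun hv => (comp_subset _ _ hv).2 rfl
      have : u' = v := by
        by_contra hne
        have h1 : u ∈ X \ {v} := comp_subset _ _ hu.2
        have h2 : u' ∈ X \ {v} := ⟨hu'.1, hne⟩
        refine hu'.2 ?_
        rw [← comp_eq_of_mem ha hu.2, ← comp_eq_of_adj h1 h2 huu']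
        exact mem_comp h2
      exact ⟨u, hu.2, this ▸ huu'.symm⟩
    have hfew : ¬ (n : ℕ∞) ≤ 𝒞.encard := by
      intro hle
      obtain ⟨T, hT, hTn⟩ := Set.exists_subset_encard_eq hle
      have hcard : Nat.card T = n := by
        rw [Nat.card_coe_set_eq, Set.ncard, hTn]
        rfl
      let e : Fin n ≃ T := (Finite.equivFinOfCardEq hcard).symm
      have hmem : ∀ i, (e i : Set V) ∈ 𝒞 := fun i => hT (e i).2
      choose a ha hva using fun i => hadj _ (hmem i)
      have hroot : ∀ i, ∃ R, a i ∈ R ∧ TreeModel G h n (e i) R := by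
        intro i
        obtain ⟨R, hR⟩ := (hmem i).2
        exact hR.reroot (ha i)
      choose Q haQ hQ using hroot
      refine hno {v} ⟨hX, conn_singleton v, Set.singleton_subset_iff.2 hvX,
        fun i => (e i : Set V), Q, hQ, ?_, ?_, fun i => ⟨v, rfl, a i, haQ i, hva i⟩⟩
      · intro i
        obtain ⟨⟨b, hb, hbe⟩, -⟩ := hmem i
        exact hbe.le.trans (comp_subset _ _)
      · intro i j hij
        refine Set.disjoint_left.2 fun u hui huj => hij (e.injective (Subtype.ext ?_))
        obtain ⟨⟨b, hb, hbe⟩, -⟩ := hmem i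
        obtain ⟨⟨c, hc, hce⟩, -⟩ := hmem j
        have hui' := hbe.le hui
        have huj' := hce.le huj
        rw [hbe, hce, ← comp_eq_of_mem hb hui', ← comp_eq_of_mem hc huj']
    have hrec : ∀ C : Set V, ∃ S : Set V, S.encard ≤ s ∧
        (C ∈ 𝒞 → ∀ D ⊆ C \ S, ∀ R, ¬ TreeModel G h (n + 1) D R) := by
      intro C
      by_cases hC : C ∈ 𝒞
      · obtain ⟨⟨b, hb, hbe⟩, -⟩ := hC
        have hCX : C ⊆ X \ {v} := hbe ▸ comp_subset _ _
        have hCc : Conn G C := hbe ▸ conn_comp hb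
        obtain ⟨S, hS, hSC⟩ := hs G C hCc (hE'.mono hCX)
          fun R hR => hno R (hR.mono (hCX.trans Set.sdiff_subset) hX)
        exact ⟨S, hS, fun _ => hSC⟩
      · exact ⟨∅, by simp, fun h => absurd h hC⟩
    choose S hS hSC using hrec
    refine ⟨{v} ∪ ⋃ C ∈ (Set.toFinite 𝒞).toFinset, S C, ?_, ?_⟩
    · have hcard : (Set.toFinite 𝒞).toFinset.card ≤ n + 1 := by
        have h1 := (Set.toFinite 𝒞).encard_eq_coe_toFinset_card
        rw [h1, not_le] at hfew
        have : (Set.toFinite 𝒞).toFinset.card < n := by exact_mod_cast hfew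
        lia
      calc ({v} ∪ ⋃ C ∈ (Set.toFinite 𝒞).toFinset, S C).encard
          ≤ ({v} : Set V).encard + (⋃ C ∈ (Set.toFinite 𝒞).toFinset, S C).encard :=
            Set.encard_union_le _ _
        _ ≤ 1 + ∑ C ∈ (Set.toFinite 𝒞).toFinset, (S C).encard := by
            gcongr
            · exact (Set.encard_singleton v).le
            · exact Finset.set_encard_biUnion_le _ _
        _ ≤ 1 + ∑ C ∈ (Set.toFinite 𝒞).toFinset, (s : ℕ∞) := by
            gcongr with C hC
            exact hS C
        _ ≤ ((1 + (n + 1) * s : ℕ) : ℕ∞) := by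
            rw [Finset.sum_const, nsmul_eq_mul]
            exact_mod_cast Nat.add_le_add_left (Nat.mul_le_mul_right s hcard) 1
    · intro D hD R hM
      have hDv : D ⊆ X \ {v} := fun u hu => ⟨(hD hu).1, fun h => (hD hu).2 (Or.inl h)⟩
      obtain ⟨d, hd⟩ := hM.conn.nonempty
      have hDC := subset_comp hDv hM.conn hd
      have hC : comp G (X \ {v}) d ∈ 𝒞 := ⟨⟨d, hDv hd, rfl⟩, R, hM.mono hDC (conn_comp (hDv hd))⟩
      refine hSC _ hC D (fun u hu => ⟨hDC hu, fun huS => (hD hu).2 (Or.inr ?_)⟩) R hM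
      exact Set.mem_iUnion₂.2 ⟨_, (Set.toFinite 𝒞).mem_toFinset.2 hC, huS⟩

/-- Graphs of bounded tree depth without a model of the tree of height `h` can be exhausted in `h`
rounds of bounded width. -/
theorem exists_elim_of_forall_not_treeModel (h n w : ℕ) :
    ∃ k : ℕ, ∀ {V : Type} [Finite V] (G : SimpleGraph V) (X : Set V), Elim G 1 w X →
      (∀ C ⊆ X, ∀ R, ¬ TreeModel G h n C R) → Elim G k h X := by
  induction h generalizing n with
  | zero =>
    refine ⟨0, fun G X _ hno => Set.eq_empty_of_forall_notMem fun x hx => ?_⟩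
    exact hno {x} (Set.singleton_subset_iff.2 hx) {x}
      ⟨conn_singleton x, conn_singleton x, subset_rfl⟩
  | succ h ih =>
    obtain ⟨k, hk⟩ := ih (n + 1)
    obtain ⟨s, hs⟩ := exists_encard_le_forall_not_treeModel h n w
    refine ⟨max s k, fun G X hE hno C hCX hC => ?_⟩
    obtain ⟨S, hS, hSC⟩ := hs G C hC (hE.mono hCX) (hno C hCX)
    refine ⟨S, hS.trans (by exact_mod_cast le_max_left s k), ?_⟩
    exact (hk G (C \ S) (hE.mono (Set.sdiff_subset.trans hCX)) hSC).mono_width (le_max_right s k)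

/-! ### Existence of cores -/

section Cores

variable {σ : Vocabulary}

/-- A structure on a type for a relational vocabulary, from its relations. -/
@[reducible]
def relStructure (σ : Vocabulary) {M : Type}
    (rel : ∀ {n : ℕ}, σ.lang.Relations n → (Fin n → M) → Prop) : σ.lang.Structure M where
  funMap := fun f => isEmptyElim f
  RelMap := rel

/-- A map that preserves all relations, as a homomorphism. -/
def relHom {A B : Str σ} (f : A.carrier → B.carrier)
    (hf : ∀ {n : ℕ} (R : σ.lang.Relations n) (x : Fin n → A.carrier),
      Structure.RelMap R x → Structure.RelMap R (fun i => f (x i))) :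
    A.carrier →[σ.lang] B.carrier where
  toFun := f
  map_fun' := fun g => isEmptyElim g
  map_rel' := hf

/-- The substructure induced on a nonempty set. -/
def inducedWeakSub (A : Str σ) (U : Set A.carrier) (hU : U.Nonempty) : WeakSub A where
  univ := U
  nonempty := hU
  interp := relStructure σ fun R x => Structure.RelMap R fun i => (x i : A.carrier)
  rel_subset := fun _ _ h => h

theorem HomTo.trans {A B C : Str σ} (hAB : HomTo A B) (hBC : HomTo B C) : HomTo A C := by
  obtain ⟨f⟩ := hAB
  obtain ⟨g⟩ := hBC
  exact ⟨g.comp f⟩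

theorem WeakSub.homTo {A : Str σ} (C : WeakSub A) : HomTo C.toStr A :=
  ⟨relHom (A := C.toStr) (fun c => (c : C.univ).1) fun R x h => C.rel_subset R x h⟩

/-- Among the nonempty sets whose induced substructure receives a homomorphism from `A`, one of
minimal size induces a core: the image of a non-injective endomorphism would be smaller. -/
theorem exists_isCoreOf (A : Str σ) : ∃ C : WeakSub A, IsCoreOf C := by
  classical
  let 𝒰 : Set (Set A.carrier) := {U | ∃ hU : U.Nonempty, HomTo A (inducedWeakSub A U hU).toStr}
  have huniv : Set.univ ∈ 𝒰 :=
    ⟨Set.univ_nonempty, ⟨relHom (B := (inducedWeakSub A Set.univ Set.univ_nonempty).toStr)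
      (fun a => (⟨a, trivial⟩ : (Set.univ : Set A.carrier))) fun _ _ h => h⟩⟩
  let U := Function.argminOn (fun U : Set A.carrier => U.ncard) 𝒰 ⟨_, huniv⟩
  have hU𝒰 : U ∈ 𝒰 := Function.argminOn_mem _ _ _
  have hmin : ∀ U' ∈ 𝒰, U.ncard ≤ U'.ncard := fun U' h =>
    Function.argminOn_le (fun U : Set A.carrier => U.ncard) 𝒰 h
  obtain ⟨hU, hA⟩ := hU𝒰
  refine ⟨inducedWeakSub A U hU, hA, fun h => ?_⟩
  let φ : U → A.carrier := fun u => (h u : U).1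
  have hne : (Set.range φ).Nonempty := by
    obtain ⟨u, hu⟩ := hU
    exact ⟨_, ⟨u, hu⟩, rfl⟩
  have hrange : Set.range φ ∈ 𝒰 := by
    refine ⟨hne, hA.trans ⟨relHom (A := (inducedWeakSub A U hU).toStr)
      (B := (inducedWeakSub A (Set.range φ) hne).toStr)
      (fun u => (⟨φ u, u, rfl⟩ : Set.range φ)) fun R x hx => ?_⟩⟩
    exact h.map_rel R x hx
  have hcard : Nat.card (Set.range φ) = Nat.card U := by
    refine le_antisymm (Finite.card_range_le φ) ?_
    rw [Nat.card_coe_set_eq, Nat.card_coe_set_eq]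
    exact hmin _ hrange
  have hinj : Function.Injective φ := by
    have hsurj : Function.Surjective (Set.rangeFactorization φ) := Set.rangeFactorization_surjective
    have hbij := (Nat.bijective_iff_surjective_and_card (Set.rangeFactorization φ)).2
      ⟨hsurj, hcard.symm⟩
    exact fun u v huv => hbij.1 (Subtype.ext huv)
  exact fun u v huv => hinj (congrArg Subtype.val huv)

end Cores

/-! ### Winning strategies from codings -/

section Strategies

variable {σ : Vocabulary}

theorem PartialHom.Extends.trans {A B : Str σ} {g₁ g₂ g₃ : PartialHom A B} (h₂₁ : g₂.Extends g₁)
    (h₃₂ : g₃.Extends g₂) : g₃.Extends g₁ := by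
  intro a ha
  obtain ⟨ha', h⟩ := h₂₁ a ha
  obtain ⟨ha'', h'⟩ := h₃₂ a ha'
  exact ⟨ha'', h'.trans h⟩

theorem PartialHom.Extends.rfl {A B : Str σ} {g : PartialHom A B} : g.Extends g :=
  fun _ ha => ⟨ha, Eq.refl _⟩

/-- Spoiler plays along the branches of the forest: at a node `t` he has asked for all elements
placed at ancestors of `t`. The answers of Duplicator on different branches agree where they
overlap, and every tuple lies on a branch, so that the answers form a homomorphism. -/
theorem solvesHom_of_hasCoding {A : Str σ} {r k : ℕ} (C : WeakSub A) (hAC : HomTo A C.toStr)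
    (hC : HasCoding (graphOf C.toStr).graph (r + 1) k) :
    SolvesHom (fun _ : Fin (r + 1) => k) A := by
  classical
  rintro B ⟨W, hW⟩
  obtain ⟨α, -, f, hf⟩ := hC
  refine hAC.trans ?_
  have hf_ne : ∀ c, f c ≠ [] := fun c => hf.ne_nil c trivial
  have hf_le : ∀ c, (f c).length ≤ r + 1 := fun c => hf.length_le c trivial
  let D : List α → Set A.carrier := fun t => {a | ∃ h : a ∈ C.univ, f (⟨a, h⟩ : C.univ) <:+ t}
  have hD_nil : D [] = ∅ := Set.eq_empty_of_forall_notMem fun a ⟨_, ha⟩ =>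
    hf_ne _ (List.suffix_nil.1 ha)
  have hD_cons : ∀ x t, D t ⊆ D (x :: t) := fun x t a ⟨h, ha⟩ =>
    ⟨h, ha.trans (List.suffix_cons x t)⟩
  have hD_card : ∀ x t, (D (x :: t) \ D t).encard ≤ k := by
    intro x t
    refine le_trans (le_trans (Set.encard_le_encard ?_)
      (Set.encard_image_le (fun c : C.univ => (c : A.carrier)) _)) (hf.encard_le (x :: t))
    rintro a ⟨⟨h, ha⟩, hat⟩
    refine ⟨⟨a, h⟩, ⟨trivial, ?_⟩, rfl⟩
    rcases List.suffix_cons_iff.1 ha with h' | h'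
    · exact h'
    · exact absurd ⟨h, h'⟩ hat
  let Good : List α → PartialHom A B → Prop := fun t g =>
    g.dom = D t ∧ ∀ i : Fin (r + 1), (i : ℕ) + 1 = t.length → g ∈ W i
  have step : ∀ x t g, ∃ g', Good t g → t.length < r + 1 → Good (x :: t) g' ∧ g'.Extends g := by
    intro x t g
    by_cases hg : Good t g ∧ t.length < r + 1
    swap
    · exact ⟨g, fun h1 h2 => absurd ⟨h1, h2⟩ hg⟩
    obtain ⟨⟨hgD, hgW⟩, hlen⟩ := hg
    cases t with
    | nil =>
      obtain ⟨g', hg', hdom⟩ := hW.first (D [x]) (by simpa [hD_nil] using hD_card x [])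
      refine ⟨g', fun _ _ => ⟨⟨hdom, fun i hi => ?_⟩, fun a ha => ?_⟩⟩
      · have : i = 0 := Fin.ext (by simpa using hi)
        exact this ▸ hg'
      · rw [hgD, hD_nil] at ha
        exact ha.elim
    | cons y t =>
      have hlen' : t.length < r := by simpa using hlen
      obtain ⟨g', hg', hext, hdom⟩ := hW.step ⟨t.length, hlen'⟩ g (hgW _ (by simp))
        (D (x :: y :: t)) (hgD ▸ hD_cons x (y :: t)) (by rw [hgD]; exact hD_card x (y :: t))
      refine ⟨g', fun _ _ => ⟨⟨hdom, fun i hi => ?_⟩, hext⟩⟩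
      have : i = (⟨t.length, hlen'⟩ : Fin r).succ := Fin.ext (by simpa using hi)
      exact this ▸ hg'
  choose next hnext using step
  let g₀ : PartialHom A B := ⟨∅, fun a => a.2.elim, fun h => absurd h Set.not_nonempty_empty⟩
  let g : List α → PartialHom A B := fun t => List.rec g₀ (fun x t g => next x t g) t
  have hg : ∀ t, t.length ≤ r + 1 → Good t (g t) := by
    intro t
    induction t with
    | nil => exact fun _ => ⟨hD_nil.symm, fun i hi => absurd hi (Nat.succ_ne_zero _)⟩
    | cons x t ih =>
      intro hlen
      have hlen' : t.length < r + 1 := by simpa using hlen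
      exact (hnext x t (g t) (ih hlen'.le) hlen').1
  have hext : ∀ s t, s <:+ t → t.length ≤ r + 1 → (g t).Extends (g s) := by
    intro s t
    induction t with
    | nil =>
      intro hst _
      rw [List.suffix_nil.1 hst]
      exact PartialHom.Extends.rfl
    | cons x t ih =>
      intro hst hlen
      have hlen' : t.length < r + 1 := by simpa using hlen
      rcases List.suffix_cons_iff.1 hst with rfl | hst
      · exact PartialHom.Extends.rfl
      · exact (ih hst hlen'.le).trans (hnext x t (g t) (hg t hlen'.le) hlen').2
  have hmem : ∀ (c : C.univ) t, f c <:+ t → t.length ≤ r + 1 → (c : A.carrier) ∈ (g t).dom := by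
    intro c t hct ht
    rw [(hg t ht).1]
    exact ⟨c.2, hct⟩
  let φ : C.univ → B.carrier := fun c =>
    (g (f c)).toFun ⟨c, hmem c _ List.suffix_rfl (hf_le c)⟩
  have hφ : ∀ (c : C.univ) t (hct : f c <:+ t) (ht : t.length ≤ r + 1),
      (g t).toFun ⟨c, hmem c t hct ht⟩ = φ c := by
    intro c t hct ht
    obtain ⟨_, h⟩ := hext _ _ hct ht c (hmem c _ List.suffix_rfl (hf_le c))
    exact h
  refine ⟨relHom (A := C.toStr) φ fun {n} R x hx => ?_⟩
  -- the elements of a tuple are pairwise adjacent, so the longest of their codes lies below the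
  -- others; for nullary relations any `c` will do, as it makes the domain nonempty
  obtain ⟨c, hc⟩ : ∃ c : C.univ, ∀ i, f (x i) <:+ f c := by
    rcases isEmpty_or_nonempty (Fin n) with hn | hn
    · obtain ⟨c, hc⟩ := C.nonempty
      exact ⟨⟨c, hc⟩, fun i => hn.elim i⟩
    · obtain ⟨i, hi⟩ := Finite.exists_max fun i => (f (x i)).length
      refine ⟨x i, fun j => ?_⟩
      by_cases hij : x j = x i
      · rw [hij]
      · have hadj : (graphOf C.toStr).graph.Adj (x j) (x i) :=
          ⟨hij, n, R, x, hx, ⟨j, rfl⟩, ⟨i, rfl⟩⟩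
        rcases hf.comparable _ trivial _ trivial hadj with h | h
        · exact h
        · rw [h.eq_of_length (le_antisymm h.length_le (hi j))]
  let y : Fin n → C.univ := x
  have key := (g (f c)).map_rel ⟨c, hmem c _ List.suffix_rfl (hf_le c)⟩ R
    (fun i => ⟨y i, hmem (y i) _ (hc i) (hf_le c)⟩) (C.rel_subset R x hx)
  have heq : (fun i => (g (f c)).toFun ⟨y i, hmem (y i) _ (hc i) (hf_le c)⟩)
      = fun i => φ (x i) := funext fun i => hφ (y i) _ (hc i) (hf_le c)
  rwa [heq] at key

end Strategies

/-! ### Codings from games: the unravelling -/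

section Unravelling

variable {σ : Vocabulary}

/-- A play of Spoiler, the latest move first: in each of at most `ℓ` rounds he asks for a set of at
most `k` further elements. -/
def IsPlay {A : Type} (ℓ k : ℕ) (t : List (Set A)) : Prop :=
  t.length ≤ ℓ ∧ ∀ N ∈ t, N.encard ≤ k

/-- The elements asked for during a play. -/
def playDom {A : Type} (t : List (Set A)) : Set A := {a | ∃ N ∈ t, a ∈ N}

theorem playDom_cons {A : Type} (N : Set A) (t : List (Set A)) :
    playDom (N :: t) = N ∪ playDom t := by
  ext a
  simp [playDom]

open Classical in
/-- The initial part of the play `t` up to the moment when `a` is asked for the first time. -/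
noncomputable def firstAsked {A : Type} : List (Set A) → A → List (Set A)
  | [], _ => []
  | N :: t, a => if a ∈ playDom t then firstAsked t a else N :: t

theorem firstAsked_cons {A : Type} {N : Set A} {t : List (Set A)} {a : A} (ha : a ∈ playDom t) :
    firstAsked (N :: t) a = firstAsked t a := if_pos ha

theorem firstAsked_suffix {A : Type} (t : List (Set A)) (a : A) : firstAsked t a <:+ t := by
  induction t with
  | nil => exact List.suffix_rfl
  | cons N t ih =>
    by_cases ha : a ∈ playDom t
    · rw [firstAsked_cons ha]
      exact ih.trans (List.suffix_cons N t)
    · rw [firstAsked, if_neg ha]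

theorem exists_firstAsked_eq_cons {A : Type} {t : List (Set A)} {a : A} (ha : a ∈ playDom t) :
    ∃ N s, firstAsked t a = N :: s ∧ a ∈ N := by
  induction t with
  | nil =>
    obtain ⟨N, hN, -⟩ := ha
    exact absurd hN (by simp)
  | cons N t ih =>
    by_cases hat : a ∈ playDom t
    · rw [firstAsked_cons hat]
      exact ih hat
    · rw [playDom_cons] at ha
      exact ⟨N, t, if_neg hat, ha.resolve_right hat⟩

/-- A pair `(t, a)` such that `a` belongs to the last move of the play `t`. -/
def IsPosition {A : Type} (ℓ k : ℕ) (p : List (Set A) × A) : Prop :=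
  IsPlay ℓ k p.1 ∧ ∃ N s, p.1 = N :: s ∧ p.2 ∈ N

theorem IsPlay.isPosition {A : Type} {ℓ k : ℕ} {t : List (Set A)} (ht : IsPlay ℓ k t) {a : A}
    (ha : a ∈ playDom t) : IsPosition ℓ k (firstAsked t a, a) :=
  ⟨⟨(firstAsked_suffix t a).length_le.trans ht.1,
    fun N hN => ht.2 N ((firstAsked_suffix t a).mem hN)⟩, exists_firstAsked_eq_cons ha⟩

theorem finite_positions {A : Type} [Finite A] (ℓ k : ℕ) :
    Finite {p : List (Set A) × A // IsPosition ℓ k p} := by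
  have h : ({t : List (Set A) | t.length ≤ ℓ} ×ˢ (Set.univ : Set A)).Finite :=
    (List.finite_length_le (Set A) ℓ).prod Set.finite_univ
  exact (h.subset fun p (hp : IsPosition ℓ k p) => ⟨hp.1.1, trivial⟩ :
    {p : List (Set A) × A | IsPosition ℓ k p}.Finite)

/-- The unravelling of `A` along the plays of the game with `ℓ` rounds of `k` elements. Every play
carries a copy of the substructure induced on the elements asked for; when a play is continued, the
copies of the elements already asked for are identified. -/
def unravelling (A : Str σ) (ℓ k : ℕ) (hℓ : 1 ≤ ℓ) (hk : 1 ≤ k) : Str σ where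
  carrier := {p : List (Set A.carrier) × A.carrier // IsPosition ℓ k p}
  finite := finite_positions ℓ k
  nonempty := by
    obtain ⟨a⟩ := A.nonempty
    exact ⟨⟨([{a}], a), ⟨by simpa using hℓ, by simpa using hk⟩, {a}, [], rfl, rfl⟩⟩
  interp := relStructure σ fun R x => ∃ t, IsPlay ℓ k t ∧
    (∀ i, (x i).1.2 ∈ playDom t ∧ (x i).1.1 = firstAsked t (x i).1.2) ∧
    Structure.RelMap R fun i => (x i).1.2

theorem unravelling_homTo (A : Str σ) (ℓ k : ℕ) (hℓ : 1 ≤ ℓ) (hk : 1 ≤ k) :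
    HomTo (unravelling A ℓ k hℓ hk) A :=
  ⟨relHom (A := unravelling A ℓ k hℓ hk) (fun p => p.1.2) fun _ _ ⟨_, _, _, h⟩ => h⟩

theorem isCoding_unravelling (A : Str σ) (ℓ k : ℕ) (hℓ : 1 ≤ ℓ) (hk : 1 ≤ k) :
    IsCoding (V := (unravelling A ℓ k hℓ hk).carrier) (graphOf (unravelling A ℓ k hℓ hk)).graph
      Set.univ ℓ k fun p => p.1.1 := by
  refine ⟨?_, fun p _ => p.2.1.1, ?_, ?_⟩
  · rintro p - hp
    obtain ⟨-, N, s, h, -⟩ := p.2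
    rw [hp] at h
    exact absurd h (by simp)
  · intro t
    by_cases hex : ∃ p : (unravelling A ℓ k hℓ hk).carrier, p.1.1 = t
    swap
    · have : {p ∈ (Set.univ : Set (unravelling A ℓ k hℓ hk).carrier) | p.1.1 = t} = ∅ :=
        Set.eq_empty_of_forall_notMem fun p hp => hex ⟨p, hp.2⟩
      rw [this]
      simp
    obtain ⟨p, rfl⟩ := hex
    obtain ⟨hplay, N, s, h, -⟩ := p.2
    have hinj : Set.InjOn (fun q : (unravelling A ℓ k hℓ hk).carrier => q.1.2)
        {q ∈ (Set.univ : Set (unravelling A ℓ k hℓ hk).carrier) | q.1.1 = p.1.1} :=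
      fun q hq q' hq' he => Subtype.ext (Prod.ext (hq.2.trans hq'.2.symm) he)
    rw [← hinj.encard_image]
    refine le_trans (Set.encard_le_encard ?_) (hplay.2 N (h ▸ List.mem_cons_self))
    rintro _ ⟨q, ⟨-, hq⟩, rfl⟩
    obtain ⟨-, N', s', h', hN'⟩ := q.2
    have : N = N' := (List.cons.inj (h.symm.trans (hq.symm.trans h'))).1
    exact this ▸ hN'
  · rintro p - q - ⟨-, n, R, x, ⟨t, -, hx, -⟩, ⟨i, rfl⟩, ⟨j, rfl⟩⟩
    refine List.suffix_or_suffix_of_suffix (l₃ := t) ?_ ?_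
    · exact (hx i).2 ▸ firstAsked_suffix _ _
    · exact (hx j).2 ▸ firstAsked_suffix _ _

/-- Duplicator wins by copying every play to its own copy in the unravelling. -/
theorem exists_strategy_unravelling (A : Str σ) (r k : ℕ) (hk : 1 ≤ k) (v : Fin (r + 1) → ℕ)
    (hv : ∀ i, v i ≤ k) :
    ∃ W, IsDuplicatorStrategy v A (unravelling A (r + 1) k (Nat.le_add_left 1 r) hk) W := by
  set U := unravelling A (r + 1) k (Nat.le_add_left 1 r) hk with hU
  let g : ∀ t : List (Set A.carrier), IsPlay (r + 1) k t → PartialHom A U := fun t ht =>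
    { dom := playDom t
      toFun := fun a => ⟨(firstAsked t a, a), ht.isPosition a.2⟩
      map_rel := fun _ _ _ x hx => ⟨t, ht, fun i => ⟨(x i).2, rfl⟩, hx⟩ }
  refine ⟨fun i => {g' | ∃ t, ∃ ht : IsPlay (r + 1) k t, t.length = i + 1 ∧ g' = g t ht}, ?_, ?_⟩
  · intro S hS
    have ht : IsPlay (r + 1) k [S] :=
      ⟨by simp, by simpa using hS.trans (by exact_mod_cast hv 0)⟩
    refine ⟨g [S] ht, ⟨[S], ht, rfl, rfl⟩, ?_⟩
    ext a
    simp [g, playDom]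
  · rintro i _ ⟨t, ht, hlen, rfl⟩ S hdom hS
    have hlen' : t.length = i + 1 := hlen
    have ht' : IsPlay (r + 1) k ((S \ playDom t) :: t) := by
      refine ⟨by simp [hlen'], ?_⟩
      intro N hN
      rcases List.mem_cons.1 hN with rfl | hN
      · exact hS.trans (by exact_mod_cast hv _)
      · exact ht.2 N hN
    refine ⟨g _ ht', ⟨_, ht', by simp [hlen'], rfl⟩, ?_, ?_⟩
    · intro a ha
      have ha' : a ∈ playDom ((S \ playDom t) :: t) := by
        rw [playDom_cons]
        exact Or.inr ha
      refine ⟨ha', Subtype.ext (Prod.ext ?_ rfl)⟩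
      exact firstAsked_cons ha
    · change playDom ((S \ playDom t) :: t) = S
      rw [playDom_cons]
      exact Set.sdiff_union_of_subset hdom

theorem IsCoding.comap {V V' α : Type} {G : SimpleGraph V} {G' : SimpleGraph V'} {ℓ k : ℕ}
    {f : V' → List α} (hf : IsCoding G' Set.univ ℓ k f) (φ : V → V') (hinj : Function.Injective φ)
    (hadj : ∀ u v, G.Adj u v → G'.Adj (φ u) (φ v)) :
    IsCoding G Set.univ ℓ k fun v => f (φ v) := by
  refine ⟨fun v _ => hf.ne_nil _ trivial, fun v _ => hf.length_le _ trivial, fun t => ?_,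
    fun u _ v _ huv => hf.comparable _ trivial _ trivial (hadj u v huv)⟩
  refine le_trans ?_ (hf.encard_le t)
  rw [← hinj.encard_image]
  refine Set.encard_le_encard ?_
  rintro _ ⟨v, hv, rfl⟩
  exact ⟨trivial, hv.2⟩

/-- If the game solves the homomorphism problem of `A`, then `A` maps to its unravelling, and a core
of `A` embeds there because the unravelling maps back to `A`. -/
theorem hasCoding_of_solvesHom {A : Str σ} {r k : ℕ} (hk : 1 ≤ k) {v : Fin (r + 1) → ℕ}
    (hv : ∀ i, v i ≤ k) (hA : SolvesHom v A) {C : WeakSub A} (hC : IsCoreOf C) :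
    HasCoding (graphOf C.toStr).graph (r + 1) k := by
  have hℓ : 1 ≤ r + 1 := Nat.le_add_left 1 r
  set U := unravelling A (r + 1) k hℓ hk with hU
  obtain ⟨φ⟩ := C.homTo.trans (hA U (exists_strategy_unravelling A r k hk v hv))
  obtain ⟨ψ⟩ := (unravelling_homTo A (r + 1) k hℓ hk).trans hC.1
  have hinj : Function.Injective φ := by
    have : Function.Injective (ψ.comp φ) := hC.2 (ψ.comp φ)
    exact Function.Injective.of_comp (f := ψ) this
  have := A.finite
  refine ⟨Set A.carrier, inferInstance, _,
    (isCoding_unravelling A (r + 1) k hℓ hk).comap (G := (graphOf C.toStr).graph) φ hinj ?_⟩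
  rintro a b ⟨hab, n, R, x, hx, ⟨i, rfl⟩, ⟨j, rfl⟩⟩
  exact ⟨fun h => hab (hinj h), n, R, fun i => φ (x i), φ.map_rel R x hx, ⟨i, rfl⟩, ⟨j, rfl⟩⟩

end Unravelling

/-! ### Codings from trees and forests -/

section BranchCode

variable {V : Type} {G : SimpleGraph V}

/-- `c v` is the list of the ancestors of `v`, from `v` up to its root, in some rooted forest with
at most `ℓ` levels in which the endpoints of every edge of `G` lie on a common branch. -/
structure IsBranchCode (G : SimpleGraph V) (ℓ : ℕ) (c : V → List V) : Prop where
  head : ∀ v, ∃ s, c v = v :: s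
  length_le : ∀ v, (c v).length ≤ ℓ
  comparable : ∀ u v, G.Adj u v → c u <:+ c v ∨ c v <:+ c u

theorem IsBranchCode.injective {ℓ : ℕ} {c : V → List V} (hc : IsBranchCode G ℓ c) :
    Function.Injective c := by
  intro u v huv
  obtain ⟨s, hs⟩ := hc.head u
  obtain ⟨t, ht⟩ := hc.head v
  rw [hs, ht] at huv
  exact (List.cons.inj huv).1

theorem IsBranchCode.hasCoding [Finite V] {ℓ : ℕ} {c : V → List V} (hc : IsBranchCode G ℓ c) :
    HasCoding G ℓ 1 := by
  refine ⟨V, inferInstance, c, fun v _ hv => ?_, fun v _ => hc.length_le v, fun t => ?_,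
    fun u _ v _ => hc.comparable u v⟩
  · obtain ⟨s, hs⟩ := hc.head v
    rw [hs] at hv
    exact absurd hv (by simp)
  · rw [Nat.cast_one]
    exact Set.encard_le_one_iff.2 fun u v hu hv => hc.injective (hu.2.trans hv.2.symm)

theorem exists_isBranchCode_of_components {ℓ : ℕ}
    (h : ∀ K : G.ConnectedComponent, ∃ c, IsBranchCode K.toSimpleGraph ℓ c) :
    ∃ c, IsBranchCode G ℓ c := by
  choose c hc using h
  have hmap : ∀ (K : G.ConnectedComponent) (v : V) (hv : G.connectedComponentMk v = K),
      (c (G.connectedComponentMk v) ⟨v, rfl⟩).map Subtype.val = (c K ⟨v, hv⟩).map Subtype.val := by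
    rintro _ v rfl
    rfl
  refine ⟨fun v => (c (G.connectedComponentMk v) ⟨v, rfl⟩).map Subtype.val, ?_, ?_, ?_⟩
  · intro v
    obtain ⟨s, hs⟩ := (hc _).head ⟨v, rfl⟩
    exact ⟨s.map Subtype.val, by rw [hs]; rfl⟩
  · intro v
    simpa using (hc _).length_le ⟨v, rfl⟩
  · intro u v huv
    have huv' : G.connectedComponentMk u = G.connectedComponentMk v :=
      SimpleGraph.ConnectedComponent.sound huv.reachable
    rw [hmap _ u huv']
    exact ((hc (G.connectedComponentMk v)).comparable ⟨u, huv'⟩ ⟨v, rfl⟩ huv).imp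
      (fun h => h.map _) fun h => h.map _

/-- The branches of a rooted tree, read off from the paths to the root. -/
theorem exists_branches {T : SimpleGraph V} (hT : T.IsTree) {root : V} {n : ℕ}
    (hn : rootedHeight T root ≤ n) :
    ∃ c, IsBranchCode T (n + 1) c ∧ ∀ a b, IsAncestor T root a b → c a <:+ c b := by
  have hex : ∀ v, ∃ p : T.Walk root v, p.IsPath := fun v => (hT.existsUnique_path root v).exists
  choose p hp using hex
  have hanc : ∀ a b, IsAncestor T root a b → (p a).reverse.support <:+ (p b).reverse.support := by
    rintro a b ⟨q, ha⟩
    have hq : (q : T.Walk root b) = p b := (hT.existsUnique_path root b).unique q.2 (hp b)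
    obtain ⟨q₁, q₂, hq₁, -, happ⟩ := q.2.mem_support_iff_exists_append.1 ha
    rw [← hq, happ, (hT.existsUnique_path root a).unique (hp a) hq₁,
      SimpleGraph.Walk.reverse_append]
    exact SimpleGraph.Walk.support_suffix_support_append _ _
  refine ⟨fun v => (p v).reverse.support, ⟨fun v => ?_, fun v => ?_, fun u v huv => ?_⟩, hanc⟩
  · exact ⟨_, (SimpleGraph.Walk.cons_tail_support _).symm⟩
  · have : ((p v).length : ℕ∞) ≤ n :=
      le_trans (le_iSup₂ (f := fun (v : V) (q : T.Path root v) => (q.1.length : ℕ∞)) v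
        ⟨p v, hp v⟩) hn
    have : (p v).length ≤ n := by exact_mod_cast this
    simpa using this
  · by_cases hu : u ∈ (p v).support
    · exact Or.inl (hanc u v ⟨⟨p v, hp v⟩, hu⟩)
    · exact Or.inr (hanc v u ⟨⟨p u, hp u⟩,
        hT.isAcyclic.mem_support_of_ne_mem_support_of_adj_of_isPath (hp u) (hp v) huv hu⟩)

theorem exists_isBranchCode_of_forestHeight_le {r : ℕ} (hG : G.IsAcyclic)
    (hr : forestHeight G ≤ r) : ∃ c, IsBranchCode G (r + 1) c := by
  refine exists_isBranchCode_of_components fun K => ?_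
  have hK : treeHeight K.toSimpleGraph < ((r + 1 : ℕ) : ℕ∞) :=
    lt_of_le_of_lt ((le_iSup (fun K : G.ConnectedComponent => treeHeight K.toSimpleGraph) K).trans
      hr) (by exact_mod_cast Nat.lt_succ_self r)
  obtain ⟨root, hroot⟩ := iInf_lt_iff.1 hK
  have hroot' : rootedHeight K.toSimpleGraph root ≤ r :=
    Order.le_of_lt_add_one (by exact_mod_cast hroot)
  obtain ⟨c, hc, -⟩ := exists_branches (hG.isTree_connectedComponent K) hroot'
  exact ⟨c, hc⟩

theorem exists_isBranchCode_of_treeDepth_le {w : ℕ} (hw : treeDepth G ≤ w) :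
    ∃ c, IsBranchCode G (w + 1) c := by
  refine exists_isBranchCode_of_components fun K => ?_
  have hK : connTreeDepth K.toSimpleGraph < ((w + 1 : ℕ) : ℕ∞) :=
    lt_of_le_of_lt ((le_iSup (fun K : G.ConnectedComponent => connTreeDepth K.toSimpleGraph)
      K).trans hw) (by exact_mod_cast Nat.lt_succ_self w)
  obtain ⟨T, hT⟩ := iInf_lt_iff.1 hK
  obtain ⟨root, hroot⟩ := iInf_lt_iff.1 hT
  obtain ⟨⟨htree, hcl⟩, hheight⟩ := iInf_lt_iff.1 hroot
  have hheight' : rootedHeight T root ≤ w := Order.le_of_lt_add_one (by exact_mod_cast hheight)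
  obtain ⟨c, hc, hanc⟩ := exists_branches htree hheight'
  exact ⟨c, hc.head, hc.length_le, fun u v huv => (hcl u v huv).imp (hanc u v) (hanc v u)⟩

end BranchCode

/-- Every vertex is placed at the topmost node of `H` whose bag contains it. -/
theorem hasCoding_of_isDeconstruction {G H : Graph} {r k : ℕ} (hH : H ∈ forests r)
    {B : H.V → Set G.V} (hB : IsDeconstruction G H B) (hk : deconstructionWidth G H B ≤ k) :
    HasCoding G.graph (r + 1) k := by
  obtain ⟨c, hc⟩ := exists_isBranchCode_of_forestHeight_le hH.1 hH.2
  have htop : ∀ g : G.V, ∃ h, g ∈ B h ∧ ∀ h', g ∈ B h' → c h <:+ c h' := fun g =>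
    Conn.exists_suffix (X := {h | g ∈ B h}) (hB.connectivity g) c
      fun u _ v _ huv => hc.comparable u v huv
  choose top htopB htop using htop
  have hbag : ∀ h, (B h).encard ≤ k := fun h =>
    le_trans (le_trans (Set.encard_le_encard (Set.subset_union_left (t := B h)))
      (le_iSup_of_le h (le_iSup_of_le h
        (le_iSup (fun _ : ReflAdj H.graph h h => (B h ∪ B h).encard) (Or.inl rfl))))) hk
  refine ⟨H.V, inferInstance, fun g => c (top g), fun g _ hg => ?_, fun g _ => hc.length_le _,
    fun t => ?_, fun g _ g' _ hgg' => ?_⟩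
  · obtain ⟨s, hs⟩ := hc.head (top g)
    rw [hs] at hg
    exact absurd hg (by simp)
  · by_cases hex : ∃ g, c (top g) = t
    · obtain ⟨g, rfl⟩ := hex
      refine le_trans (Set.encard_le_encard ?_) (hbag (top g))
      rintro g' ⟨-, hg'⟩
      exact hc.injective hg' ▸ htopB g'
    · have : {g ∈ (Set.univ : Set G.V) | c (top g) = t} = ∅ :=
        Set.eq_empty_of_forall_notMem fun g hg => hex ⟨g, hg.2⟩
      rw [this]
      simp
  · obtain ⟨h, h', hhh', hsub⟩ := hB.coverage g g' (Or.inr hgg')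
    -- the lower one of the two nodes has both vertices in bags at or above it
    obtain ⟨t, ht, ht'⟩ : ∃ t, c h <:+ t ∧ c h' <:+ t := by
      rcases hhh' with rfl | hadj
      · exact ⟨c h, List.suffix_rfl, List.suffix_rfl⟩
      · rcases hc.comparable h h' hadj with hs | hs
        · exact ⟨c h', hs, List.suffix_rfl⟩
        · exact ⟨c h, List.suffix_rfl, hs⟩
    have hle : ∀ x ∈ ({g, g'} : Set G.V), c (top x) <:+ t := by
      intro x hx
      rcases hsub hx with hx | hx
      · exact (htop x h hx).trans ht
      · exact (htop x h' hx).trans ht'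
    exact List.suffix_or_suffix_of_suffix (hle g (Or.inl rfl)) (hle g' (Or.inr rfl))

/-! ### Level functions on forests -/

section Levels

variable {V : Type} {T : SimpleGraph V}

/-- `d` is the depth function of a rooted forest `T`: depths of adjacent vertices differ by one, and
every vertex has at most one neighbour above it, its parent. -/
structure IsLevel (T : SimpleGraph V) (d : V → ℕ) : Prop where
  adj : ∀ u v, T.Adj u v → d v = d u + 1 ∨ d u = d v + 1
  unique : ∀ u w v, T.Adj u v → T.Adj w v → d v = d u + 1 → d v = d w + 1 → u = w

/-- A deepest vertex of a cycle would have two different parents. -/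
theorem IsLevel.isAcyclic {d : V → ℕ} (hd : IsLevel T d) : T.IsAcyclic := by
  classical
  intro v p hp
  obtain ⟨m, hm, hmax⟩ : ∃ m ∈ p.support, ∀ u ∈ p.support, d u ≤ d m := by
    obtain ⟨m, hm, hmax⟩ := p.support.toFinset.exists_max_image d ⟨v, by simp⟩
    exact ⟨m, by simpa using hm, fun u hu => hmax u (by simpa using hu)⟩
  have hq : (p.rotate m hm).IsCycle := hp.rotate hm
  set q := p.rotate m hm with hq_def
  have hle : ∀ u ∈ q.support, d u ≤ d m := fun u hu =>
    hmax u ((p.mem_support_rotate_iff m hm).1 hu)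
  have h1 : T.Adj m q.snd := SimpleGraph.Walk.adj_snd hq.not_nil
  have h2 : T.Adj q.penultimate m := SimpleGraph.Walk.adj_penultimate hq.not_nil
  have l1 := hle _ (q.getVert_mem_support 1)
  have l2 := hle _ (q.getVert_mem_support (q.length - 1))
  refine hq.snd_ne_penultimate (hd.unique _ _ m h1.symm h2 ?_ ?_)
  · rcases hd.adj _ _ h1 with h | h
    · change d (q.getVert 1) = _ at h
      lia
    · exact h
  · rcases hd.adj _ _ h2 with h | h
    · exact h
    · change d (q.getVert (q.length - 1)) = _ at h
      lia

/-- A path to a root starts with a step to the parent, as otherwise it would have to come back. -/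
theorem IsLevel.length_eq {d : V → ℕ} (hd : IsLevel T d) {v root : V} (p : T.Walk v root)
    (hp : p.IsPath) (hroot : d root = 0) :
    p.length = d v ∧ (d v ≠ 0 → ∃ x ∈ p.support, T.Adj x v ∧ d v = d x + 1) := by
  induction p with
  | nil => exact ⟨hroot.symm, fun h => absurd hroot h⟩
  | @cons v w root h q ih =>
    rw [SimpleGraph.Walk.cons_isPath_iff] at hp
    obtain ⟨hlen, hx⟩ := ih hp.1 hroot
    have hvw : d v = d w + 1 := by
      rcases hd.adj v w h with hvw | hvw
      · obtain ⟨x, hxq, hxw, hdx⟩ := hx (by lia)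
        exact absurd (hd.unique v x w h hxw hvw hdx ▸ hxq) hp.2
      · exact hvw
    refine ⟨by rw [SimpleGraph.Walk.length_cons, hlen, hvw], fun _ => ⟨w, ?_, h.symm, hvw⟩⟩
    exact List.mem_cons_of_mem _ q.start_mem_support

theorem IsLevel.rootedHeight_le {d : V → ℕ} (hd : IsLevel T d) {root : V} (hroot : d root = 0)
    {n : ℕ} (hn : ∀ v, d v ≤ n) : rootedHeight T root ≤ n := by
  refine iSup₂_le fun v p => ?_
  have := (hd.length_eq p.1.reverse p.2.reverse hroot).1
  rw [SimpleGraph.Walk.length_reverse] at this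
  rw [this]
  exact_mod_cast hn v

theorem IsLevel.forestHeight_le {d : V → ℕ} (hd : IsLevel T d)
    (hpar : ∀ v, d v ≠ 0 → ∃ u, T.Adj u v ∧ d v = d u + 1) {n : ℕ} (hn : ∀ v, d v ≤ n) :
    forestHeight T ≤ n := by
  refine iSup_le fun K => ?_
  have hK : IsLevel K.toSimpleGraph fun v => d v.1 :=
    ⟨fun u v huv => hd.adj u.1 v.1 huv, fun u w v huv hwv h1 h2 =>
      Subtype.ext (hd.unique u.1 w.1 v.1 huv hwv h1 h2)⟩
  obtain ⟨root, hmin⟩ : ∃ root : K, ∀ v : K, d root.1 ≤ d v.1 := by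
    have : Nonempty K := K.nonempty_supp.to_subtype
    exact ⟨Function.argmin (fun v : K => d v.1), fun v => Function.argmin_le (fun v : K => d v.1) v⟩
  have hroot : d root.1 = 0 := by
    by_contra h
    obtain ⟨u, hu, hdu⟩ := hpar root.1 h
    have huK : u ∈ K.supp := (K.mem_supp_congr_adj hu).2 root.2
    have := hmin ⟨u, huK⟩
    change d root.1 ≤ d u at this
    lia
  exact (iInf_le _ root).trans (hK.rootedHeight_le hroot fun v => hn v.1)

end Levels

/-! ### Deconstructions from codings -/

theorem IsCoding.encard_suffix_le {V α : Type} {G : SimpleGraph V} {ℓ k : ℕ} {f : V → List α}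
    (hf : IsCoding G Set.univ ℓ k f) (t : List α) :
    {v | f v <:+ t}.encard ≤ (t.length * k : ℕ) := by
  induction t with
  | nil =>
    have : {v | f v <:+ []} = ∅ :=
      Set.eq_empty_of_forall_notMem fun v hv => hf.ne_nil v trivial (List.suffix_nil.1 hv)
    rw [this]
    simp
  | cons x t ih =>
    have hsub : {v | f v <:+ x :: t} ⊆ {v | f v <:+ t} ∪ {v ∈ Set.univ | f v = x :: t} := by
      intro v hv
      rcases List.suffix_cons_iff.1 hv with h | h
      · exact Or.inr ⟨trivial, h⟩
      · exact Or.inl h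
    calc {v | f v <:+ x :: t}.encard
        ≤ {v | f v <:+ t}.encard + {v ∈ Set.univ | f v = x :: t}.encard :=
          (Set.encard_le_encard hsub).trans (Set.encard_union_le _ _)
      _ ≤ (t.length * k : ℕ) + (k : ℕ∞) := add_le_add ih (hf.encard_le _)
      _ = ((x :: t).length * k : ℕ) := by
          rw [List.length_cons, Nat.succ_mul]
          norm_cast

/-- The forest of all nonempty lists of length at most `ℓ`, where the parent of `x :: t` is `t`. -/
def listForest (α : Type) [Finite α] [Nonempty α] (ℓ : ℕ) (hℓ : 1 ≤ ℓ) : Graph where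
  V := {t : List α // t ≠ [] ∧ t.length ≤ ℓ}
  finite := ((List.finite_length_le α ℓ).subset fun _ ht => ht.2 :
    {t : List α | t ≠ [] ∧ t.length ≤ ℓ}.Finite)
  nonempty := ⟨⟨[Classical.arbitrary α], by simp, by simpa using hℓ⟩⟩
  graph :=
    { Adj := fun s t => (∃ x, t.1 = x :: s.1) ∨ (∃ x, s.1 = x :: t.1)
      symm := ⟨fun _ _ hst => hst.symm⟩
      loopless := ⟨fun s hs => by
        rcases hs with ⟨x, hx⟩ | ⟨x, hx⟩ <;> simpa using congrArg List.length hx⟩ }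

theorem listForest_mem_forests (α : Type) [Finite α] [Nonempty α] (r : ℕ) :
    listForest α (r + 1) (Nat.le_add_left 1 r) ∈ forests r := by
  have hpos : ∀ t : (listForest α (r + 1) (Nat.le_add_left 1 r)).V, 0 < t.1.length := fun t =>
    List.length_pos_iff.2 t.2.1
  have hd : IsLevel (listForest α (r + 1) (Nat.le_add_left 1 r)).graph
      fun t => t.1.length - 1 := by
    refine ⟨?_, ?_⟩
    · rintro s t (⟨x, hx⟩ | ⟨x, hx⟩)
      · left
        have := hpos s
        have := congrArg List.length hx
        rw [List.length_cons] at this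
        lia
      · right
        have := hpos t
        have := congrArg List.length hx
        rw [List.length_cons] at this
        lia
    · have key : ∀ u v : (listForest α (r + 1) (Nat.le_add_left 1 r)).V,
          (listForest α (r + 1) (Nat.le_add_left 1 r)).graph.Adj u v →
          v.1.length - 1 = u.1.length - 1 + 1 → u.1 = v.1.tail := by
        rintro u v (⟨x, hx⟩ | ⟨x, hx⟩) h
        · rw [hx, List.tail_cons]
        · have := hpos v
          have := congrArg List.length hx
          rw [List.length_cons] at this
          lia
      exact fun u w v huv hwv h1 h2 => Subtype.ext ((key u v huv h1).trans (key w v hwv h2).symm)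
  refine ⟨hd.isAcyclic, hd.forestHeight_le ?_ fun t => Nat.sub_le_of_le_add t.2.2⟩
  rintro ⟨_ | ⟨x, t⟩, ht, hlen⟩ hne
  · exact absurd rfl ht
  · have htne : t ≠ [] := by
      rintro rfl
      exact hne rfl
    have hlen' : t.length + 1 ≤ r + 1 := hlen
    refine ⟨⟨t, htne, by lia⟩, Or.inl ⟨x, rfl⟩, ?_⟩
    have := List.length_pos_iff.2 htne
    change t.length + 1 - 1 = t.length - 1 + 1
    lia

theorem exists_isDeconstruction_of_hasCoding {G : Graph} {r k : ℕ}
    (h : HasCoding G.graph (r + 1) k) : ∃ H ∈ forests r, ∃ B : H.V → Set G.V,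
      IsDeconstruction G H B ∧ deconstructionWidth G H B ≤ (2 * ((r + 1) * k) : ℕ) := by
  obtain ⟨α, _, f, hf⟩ := h
  have hα : Nonempty α := by
    obtain ⟨g⟩ := G.nonempty
    obtain ⟨x, -⟩ := List.exists_mem_of_ne_nil _ (hf.ne_nil g trivial)
    exact ⟨x⟩
  have hnode : ∀ g, f g ≠ [] ∧ (f g).length ≤ r + 1 := fun g =>
    ⟨hf.ne_nil g trivial, hf.length_le g trivial⟩
  refine ⟨_, listForest_mem_forests α r, fun t => {g | f g <:+ t.1}, ⟨?_, ?_⟩, ?_⟩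
  · intro g g' hgg'
    obtain ⟨t, ht, ht'⟩ : ∃ t : (listForest α (r + 1) (Nat.le_add_left 1 r)).V,
        f g <:+ t.1 ∧ f g' <:+ t.1 := by
      rcases hgg' with rfl | hadj
      · exact ⟨⟨f g, hnode g⟩, List.suffix_rfl, List.suffix_rfl⟩
      · rcases hf.comparable g trivial g' trivial hadj with hs | hs
        · exact ⟨⟨f g', hnode g'⟩, hs, List.suffix_rfl⟩
        · exact ⟨⟨f g, hnode g⟩, List.suffix_rfl, hs⟩
    refine ⟨t, t, Or.inl rfl, ?_⟩
    rintro x (rfl | rfl)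
    · exact Or.inl ht
    · exact Or.inl ht'
  · intro g
    let X : Set (listForest α (r + 1) (Nat.le_add_left 1 r)).V := {t | f g <:+ t.1}
    let top : X := ⟨⟨f g, hnode g⟩, List.suffix_rfl⟩
    have hreach : ∀ (t : List α) (ht : t ≠ [] ∧ t.length ≤ r + 1) (htX : f g <:+ t),
        ((listForest α (r + 1) (Nat.le_add_left 1 r)).graph.induce X).Reachable
          top ⟨⟨t, ht⟩, htX⟩ := by
      intro t
      induction t with
      | nil => exact fun ht => absurd rfl ht.1
      | cons x t ih =>
        intro ht htX
        by_cases he : f g = x :: t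
        · have : top = ⟨⟨x :: t, ht⟩, htX⟩ := Subtype.ext (Subtype.ext he)
          rw [this]
        · have htX' : f g <:+ t := (List.suffix_cons_iff.1 htX).resolve_left he
          have htne : t ≠ [] := by
            rintro rfl
            exact (hnode g).1 (List.suffix_nil.1 htX')
          have hlen : t.length ≤ r + 1 := by
            have : t.length + 1 ≤ r + 1 := ht.2
            lia
          refine (ih ⟨htne, hlen⟩ htX').trans (SimpleGraph.Adj.reachable ?_)
          exact Or.inl ⟨x, rfl⟩
    exact
      { preconnected := fun s t => (hreach s.1.1 s.1.2 s.2).symm.trans (hreach t.1.1 t.1.2 t.2)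
        nonempty := ⟨top⟩ }
  · refine iSup_le fun s => iSup_le fun t => iSup_le fun _ => ?_
    have hbag : ∀ t : (listForest α (r + 1) (Nat.le_add_left 1 r)).V,
        {g | f g <:+ t.1}.encard ≤ ((r + 1) * k : ℕ) := fun t =>
      (hf.encard_suffix_le t.1).trans (by exact_mod_cast Nat.mul_le_mul_right k t.2.2)
    refine (Set.encard_union_le _ _).trans ((add_le_add (hbag s) (hbag t)).trans ?_)
    rw [two_mul]
    norm_cast

/-! ### Tree depth from codings -/

section TreeDepth

variable {V : Type} {G : SimpleGraph V}

theorem Elim.succ {k ℓ : ℕ} {X : Set V} (h : Elim G k ℓ X) : Elim G k (ℓ + 1) X := fun _ hC _ =>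
  ⟨∅, by simp, h.mono (Set.sdiff_subset.trans hC)⟩

theorem Elim.mono_depth {k ℓ ℓ' : ℕ} (hℓ : ℓ ≤ ℓ') {X : Set V} (h : Elim G k ℓ X) :
    Elim G k ℓ' X := by
  induction hℓ with
  | refl => exact h
  | step _ ih => exact ih.succ

theorem Elim.add_encard {m k : ℕ} {X S : Set V} (hS : S.encard ≤ k) (h : Elim G 1 m (X \ S)) :
    Elim G 1 (m + k) X := by
  induction k generalizing X S with
  | zero =>
    obtain rfl : S = ∅ := Set.encard_eq_zero.1 (nonpos_iff_eq_zero.1 (by simpa using hS))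
    simpa using h
  | succ k ih =>
    rcases S.eq_empty_or_nonempty with rfl | ⟨v, hv⟩
    · rw [Set.sdiff_empty] at h
      exact h.mono_depth (Nat.le_add_right _ _)
    · have hS' : (S \ {v}).encard ≤ k := by
        rw [← Set.encard_sdiff_singleton_add_one hv] at hS
        exact (ENat.add_le_add_iff_right ENat.one_ne_top).1 (by exact_mod_cast hS)
      have hv' : Elim G 1 (m + k) (X \ {v}) := by
        refine ih hS' (h.mono ?_)
        rintro u ⟨⟨hu, huv⟩, huS⟩
        exact ⟨hu, fun h => huS ⟨h, huv⟩⟩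
      exact fun C hC _ => ⟨{v}, by simp, hv'.mono (Set.sdiff_subset_sdiff_left hC)⟩

theorem Elim.of_conn {k ℓ : ℕ} {X : Set V} (h : ∀ C ⊆ X, Conn G C → Elim G k ℓ C) :
    Elim G k ℓ X := by
  cases ℓ with
  | zero =>
    refine Set.eq_empty_of_forall_notMem fun x hx => ?_
    exact Set.singleton_ne_empty x (h {x} (Set.singleton_subset_iff.2 hx) (conn_singleton x))
  | succ ℓ => exact fun C hCX hC => h C hCX hC C subset_rfl hC

/-- The vertices of one round can be removed one after the other. -/
theorem Elim.one {k ℓ : ℕ} {X : Set V} (h : Elim G k ℓ X) : Elim G 1 (ℓ * k) X := by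
  induction ℓ generalizing X with
  | zero => simpa [Elim] using h
  | succ ℓ ih =>
    refine Elim.of_conn fun C hCX hC => ?_
    obtain ⟨S, hS, hE⟩ := h C hCX hC
    rw [Nat.succ_mul]
    exact (ih hE).add_encard hS

/-- A coding of width one is injective, so it makes the vertices of a connected graph into a tree
order in which adjacent vertices are comparable. Its Hasse diagram is the required tree, where the
depth of a vertex is the number of its strict ancestors. -/
theorem connTreeDepth_le_of_hasCoding [Finite V] (hG : G.Connected) {n : ℕ}
    (h : HasCoding G n 1) : connTreeDepth G ≤ n := by
  obtain ⟨α, -, f, hf⟩ := h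
  have hinj : Function.Injective f := fun u v huv => by
    have := hf.encard_le (f v)
    rw [Nat.cast_one] at this
    exact Set.encard_le_one_iff.1 this u v ⟨trivial, huv⟩ ⟨trivial, rfl⟩
  have antisymm : ∀ {u v}, f u <:+ f v → f v <:+ f u → u = v := fun h1 h2 =>
    hinj (h1.eq_of_length (le_antisymm h1.length_le h2.length_le))
  -- `Cov u v`: `u` is the lowest strict ancestor of `v`
  let below : V → Set V := fun v => {u | f u <:+ f v ∧ u ≠ v}
  let Cov : V → V → Prop := fun u v => u ∈ below v ∧ ∀ w ∈ below v, f w <:+ f u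
  let d : V → ℕ := fun v => (below v).ncard
  have hcov_d : ∀ u v, Cov u v → d v = d u + 1 := by
    rintro u v ⟨huv, hmax⟩
    have hbelow : below v = insert u (below u) := by
      ext w
      constructor
      · intro hw
        by_cases hwu : w = u
        · exact Or.inl hwu
        · exact Or.inr ⟨hmax w hw, hwu⟩
      · rintro (rfl | ⟨hwu, hne⟩)
        · exact huv
        · refine ⟨hwu.trans huv.1, ?_⟩
          rintro rfl
          exact huv.2 (antisymm huv.1 hwu)
    change (below v).ncard = (below u).ncard + 1
    rw [hbelow, Set.ncard_insert_of_notMem fun h => h.2 rfl]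
  have hcov_ex : ∀ v, d v ≠ 0 → ∃ u, Cov u v := by
    intro v hv
    have hne : (below v).Nonempty := by
      rw [Set.nonempty_iff_ne_empty]
      intro h
      exact hv (by simp [d, h])
    obtain ⟨u, hu, hmax⟩ := Set.exists_max_image (below v) (fun u => (f u).length)
      (Set.toFinite _) hne
    refine ⟨u, hu, fun w hw => ?_⟩
    rcases List.suffix_or_suffix_of_suffix hw.1 hu.1 with h | h
    · exact h
    · rw [h.eq_of_length (le_antisymm h.length_le (hmax w hw))]
  let T : SimpleGraph V :=
    { Adj := fun u v => Cov u v ∨ Cov v u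
      symm := ⟨fun _ _ huv => huv.symm⟩
      loopless := ⟨fun v hv => by rcases hv with hv | hv <;> exact hv.1.2 rfl⟩ }
  have hcov : ∀ u v, T.Adj u v → d v = d u + 1 → Cov u v := by
    rintro u v (huv | huv) hd
    · exact huv
    · have := hcov_d v u huv
      lia
  have hd : IsLevel T d := by
    refine ⟨fun u v huv => huv.imp (hcov_d u v) (hcov_d v u), fun u w v huv hwv h1 h2 => ?_⟩
    have hu := hcov u v huv h1
    have hw := hcov w v hwv h2
    exact antisymm (hw.2 u hu.1) (hu.2 w hw.1)
  obtain ⟨root, -, hroot⟩ := Conn.exists_suffix (G := G) (X := Set.univ)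
    (SimpleGraph.induceUnivIso G |>.connected_iff.2 hG) f hf.comparable
  have hd_root : d root = 0 := by
    have : below root = ∅ := Set.eq_empty_of_forall_notMem fun u hu =>
      hu.2 (antisymm hu.1 (hroot u trivial))
    simp [d, this]
  have hreach : ∀ v, T.Reachable root v := by
    intro v
    induction hm : d v using Nat.strong_induction_on generalizing v with
    | _ m ih =>
      by_cases hv : d v = 0
      · have : root = v := by
          by_contra hne
          have : root ∈ below v := ⟨hroot v trivial, hne⟩
          rw [Set.ncard_eq_zero] at hv
          exact Set.eq_empty_iff_forall_notMem.1 hv root this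
        rw [this]
      · obtain ⟨u, hu⟩ := hcov_ex v hv
        have hlt := hcov_d u v hu
        refine (ih (d u) (by lia) u rfl).trans (SimpleGraph.Adj.reachable ?_)
        exact Or.inl hu
  have htree : T.IsTree := by
    have : Nonempty V := ⟨root⟩
    exact ⟨⟨fun u v => (hreach u).symm.trans (hreach v)⟩, hd.isAcyclic⟩
  have hanc : ∀ u v, f u <:+ f v → IsAncestor T root u v := by
    intro u v huv
    obtain ⟨p, hp, -⟩ := htree.existsUnique_path v root
    refine ⟨⟨p.reverse, hp.reverse⟩, ?_⟩
    have key : ∀ (v root : V) (p : T.Walk v root), (∀ w, f root <:+ f w) → f u <:+ f v →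
        u ∈ p.support := by
      intro v root p hroot huv
      induction p with
      | nil => simpa using antisymm huv (hroot u)
      | @cons v w _ h q ih =>
        rcases h with h | h
        · exact List.mem_cons_of_mem _ (ih hroot (huv.trans h.1.1))
        · by_cases huv' : u = v
          · exact huv' ▸ List.mem_cons_self
          · exact List.mem_cons_of_mem _ (ih hroot (h.2 u ⟨huv, huv'⟩))
    simpa using key v root p (fun w => hroot w trivial) huv
  have hcl : InClosure G T root := ⟨htree, fun u v huv =>
    (hf.comparable u trivial v trivial huv).imp (hanc u v) (hanc v u)⟩
  refine (iInf₂_le_of_le T root (iInf_le_of_le hcl le_rfl)).trans (hd.rootedHeight_le hd_root ?_)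
  intro v
  have h1 : (below v).encard ≤ ((f v).length * 1 : ℕ) :=
    (Set.encard_le_encard fun u hu => hu.1).trans (hf.encard_suffix_le (f v))
  rw [← (Set.toFinite (below v)).cast_ncard_eq, mul_one] at h1
  have h2 : d v ≤ (f v).length := by exact_mod_cast h1
  exact h2.trans (hf.length_le v trivial)

theorem treeDepth_le_of_hasCoding [Finite V] {ℓ k : ℕ} (h : HasCoding G ℓ k) :
    treeDepth G ≤ (ℓ * k : ℕ) := by
  obtain ⟨α, hα, f, hf⟩ := h.elim.one.hasCoding
  refine iSup_le fun K => ?_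
  exact connTreeDepth_le_of_hasCoding K.connected_toSimpleGraph ⟨α, hα, _,
    hf.comap (Subtype.val : K → V) Subtype.val_injective fun _ _ huv => huv⟩

end TreeDepth

end HomGame

/-! ### Equivalence of the three conditions -/

open HomGame in
theorem mainTheorem7 (𝒜 : Set (Σ σ : HomGame.Vocabulary, HomGame.Str σ)) (r : ℕ) :
    List.TFAE
      [∃ v : Fin (r + 1) → ℕ, HomGame.SolvesPHom v 𝒜,
       HomGame.Prec (HomGame.graphCore 𝒜) (HomGame.forests r),
       HomGame.BoundedTreeDepth (HomGame.graphCore 𝒜) ∧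
         HomGame.stackDepth (HomGame.graphCore 𝒜) ≤ (r : ℕ∞)] := by
  tfae_have 1 → 2 := by
    rintro ⟨v, hv⟩
    -- the summand `1` makes the unravelling nonempty also if `v = 0`
    let k : ℕ := 1 + ∑ i, v i
    have hk : ∀ i, v i ≤ k := fun i =>
      (Finset.single_le_sum (fun _ _ => Nat.zero_le _) (Finset.mem_univ i)).trans
        (Nat.le_add_left _ 1)
    have hk1 : 1 ≤ k := Nat.le_add_right 1 _
    refine ⟨2 * ((r + 1) * k), by nlinarith, ?_⟩
    rintro _ ⟨A, hA, C, hC, rfl⟩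
    exact exists_isDeconstruction_of_hasCoding (hasCoding_of_solvesHom hk1 hk (hv A hA) hC)
  tfae_have 2 → 1 := by
    rintro ⟨k, -, hk⟩
    refine ⟨fun _ => k, fun A hA => ?_⟩
    obtain ⟨C, hC⟩ := exists_isCoreOf A.2
    obtain ⟨H, hH, B, hB, hwidth⟩ := hk _ ⟨A, hA, C, hC, rfl⟩
    exact solvesHom_of_hasCoding C hC.1 (hasCoding_of_isDeconstruction hH hB hwidth)
  tfae_have 2 → 3 := by
    rintro ⟨k, -, hk⟩
    have hcode : ∀ G ∈ graphCore 𝒜, HasCoding G.graph (r + 1) k := fun G hG => by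
      obtain ⟨H, hH, B, hB, hwidth⟩ := hk G hG
      exact hasCoding_of_isDeconstruction hH hB hwidth
    refine ⟨⟨(r + 1) * k, fun G hG => treeDepth_le_of_hasCoding (hcode G hG)⟩, ?_⟩
    refine iSup₂_le fun h hh => ?_
    obtain ⟨G, hG, X, R, hM⟩ := fullTree_mem_minors_iff.1 (hh (k + 1) (Nat.le_add_left 1 k))
    have := hM.height_lt_of_elim (Nat.lt_succ_self k) (hcode G hG).elim (Set.subset_univ X)
    exact_mod_cast Nat.le_of_lt_succ this
  tfae_have 3 → 2 := by
    rintro ⟨⟨w, hw⟩, hs⟩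
    obtain ⟨n, hn⟩ : ∃ n, fullTree (r + 1) n ∉ minors (graphCore 𝒜) := by
      by_contra! hall
      have h1 : ((r + 1 : ℕ) : ℕ∞) ≤ stackDepth (graphCore 𝒜) :=
        le_iSup₂ (f := fun (h : ℕ) (_ : ∀ k : ℕ, 1 ≤ k → fullTree h k ∈ minors (graphCore 𝒜)) =>
          (h : ℕ∞)) (r + 1) fun k _ => hall k
      have h2 : r + 1 ≤ r := by exact_mod_cast h1.trans hs
      lia
    obtain ⟨k, hk⟩ := exists_elim_of_forall_not_treeModel (r + 1) n (w + 1)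
    have hcode : ∀ G ∈ graphCore 𝒜, HasCoding G.graph (r + 1) k := fun G hG => by
      obtain ⟨c, hc⟩ := exists_isBranchCode_of_treeDepth_le (hw G hG)
      exact (hk G.graph Set.univ hc.hasCoding.elim fun X _ R hM =>
        hn (fullTree_mem_minors_iff.2 ⟨G, hG, X, R, hM⟩)).hasCoding
    refine ⟨max 1 (2 * ((r + 1) * k)), le_max_left _ _, fun G hG => ?_⟩
    obtain ⟨H, hH, B, hB, hwidth⟩ := exists_isDeconstruction_of_hasCoding (hcode G hG)
    exact ⟨H, hH, B, hB, hwidth.trans (by exact_mod_cast le_max_right 1 (2 * ((r + 1) * k)))⟩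
  tfae_finish
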